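/- Let $\alpha\in(0,1)$ be irrational, let $R(x)=x+\alpha \pmod 1$ on $[0,1)$, let $\lambda$ be Lebesgue measure on $[0,1)$, let $\beta>1$, and let $f(x)=x^{-\beta}$ for $x\in(0,1)$, $f(0)=0$. Let $a_1,a_2,\dots$ be the continued fraction coefficients of $\alpha$, that is, $\alpha=\cfrac{1}{a_1+\cfrac{1}{a_2+\cdots}}$, and let $q_0=0$, $q_1=1$, $q_{n+1}=a_nq_n+q_{n-1}$ for $n\ge 1$. For $N\ge 1$ let $n=n(N)$ be the index with $q_n\le N<q_{n+1}$, and let $N=\sum_{j=1}^n b_jq_j$ with $b_j=b_j(N)$ be the Ostrowski expansion of $N$: the $b_j$ are integers with $0\le b_j\le a_j$ and $\sum_{j=1}^J b_jq_j<q_{J+1}$ for $1\le J\le n-1$; in particular $b_n=\lfloor N/q_n\rfloor$. For $0\le k\le N$ let $$S_N^{k}(f)(x)=\sum_{m=0}^{N-1}f(R^m x)-\max_{0\le n_1<\dots<n_k\le N-1}\ \sum_{j=1}^k f(R^{n_j}x),$$ and $S_N^k(f)=0$ if $k>N$. Let $k(N)$ be a monotone sequence of non-negative integers with $k(N)=o(N)$.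 Then the following are equivalent. (I) There are $d_N>0$ such that $S_N^{k(N)}(f)(x)/d_N\to 1$ as $N\to\infty$, uniformly in $x\in[0,1)$. (II) There are $d_N>0$ such that $\lambda\left(\left|\frac{S_N^{k(N)}(f)}{d_N}-1\right|>\epsilon\right)\to0$ as $N\to\infty$, for every $\epsilon>0$. (III) $\displaystyle\frac{k(N)}{\max\left(b_n,\max_{j\le n-1}a_j\right)}\to\infty$ as $N\to\infty$. Moreover, for every given sequence $d_N>0$, the convergence in (I) holds with this $d_N$ if and only if the convergence in (II) holds with this $d_N$, and this is the case if and only if (III) holds and $d_N\sim\frac{1}{\beta-1}N^\beta k(N)^{1-\beta}$ as $N\to\infty$. In particular, if (III) holds, the uniform law in (I) holds with $d_N=\frac{1}{\beta-1}N^\beta k(N)^{1-\beta}$. -/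

import Mathlib

open Filter Topology MeasureTheory Asymptotics

noncomputable section

namespace TrimmedRotation

/-! ## Continued fractions and Ostrowski expansions -/

/-- The continued fraction coefficient `a_j`, `j ≥ 1`, of `α ∈ (0,1)`, so that
`α = 1 / (a_1 + 1 / (a_2 + ...))`. (The value at `j = 0` is never used.) -/
def cfCoeff (α : ℝ) (j : ℕ) : ℕ :=
  ⌊((GenContFract.of α).partDens.get? (j - 1)).getD 0⌋₊

/-- The denominators `q_n`, with `q_1 = 1` and `q_2 = a_1`; the auxiliary value `q_0 = 0` makes the
recursion `q_{n+1} = a_n q_n + q_{n-1}` valid from `n = 1` on. -/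
def cfDenom (α : ℝ) : ℕ → ℕ
  | 0 => 0
  | 1 => 1
  | n + 2 => cfCoeff α (n + 1) * cfDenom α (n + 1) + cfDenom α n

/-- The index `n` with `N ∈ [q_n, q_{n+1} - 1]`. -/
def ostrowskiIndex (α : ℝ) (N : ℕ) : ℕ :=
  Nat.findGreatest (fun n => cfDenom α n ≤ N) (N + 1)

/-- `b_1, …, b_n` are the digits of the Ostrowski expansion of `N ∈ [q_n, q_{n+1} - 1]`. -/
structure IsOstrowski (α : ℝ) (N n : ℕ) (b : ℕ → ℕ) : Prop where
  one_le : 1 ≤ n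
  lower : cfDenom α n ≤ N
  upper : N < cfDenom α (n + 1)
  digit_le : ∀ j ∈ Finset.Icc 1 n, b j ≤ cfCoeff α j
  sum_eq : N = ∑ j ∈ Finset.Icc 1 n, b j * cfDenom α j
  partial_lt : ∀ J, 1 ≤ J → J < n →
    ∑ j ∈ Finset.Icc 1 J, b j * cfDenom α j < cfDenom α (J + 1)

/-- The remainder of `N` after division by `q_n, q_{n-1}, …, q_{n-i+1}` in succession, where
`n` is the index of `N`. -/
def ostrowskiRem (α : ℝ) (N : ℕ) : ℕ → ℕ
  | 0 => N
  | i + 1 => ostrowskiRem α N i % cfDenom α (ostrowskiIndex α N - i)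

/-- The digit `b_j` of the Ostrowski expansion of `N`, for `1 ≤ j ≤ n`. -/
def ostrowskiDigit (α : ℝ) (N j : ℕ) : ℕ :=
  ostrowskiRem α N (ostrowskiIndex α N - j) / cfDenom α j

lemma exists_get?_partDens {α : ℝ} (hα : Irrational α) (i : ℕ) :
    ∃ c : ℝ, (GenContFract.of α).partDens.get? i = some c := by
  have hnt : ¬ (GenContFract.of α).TerminatedAt i := by
    intro h
    have : (GenContFract.of α).Terminates := ⟨i, h⟩
    rw [GenContFract.terminates_iff_rat] at this
    obtain ⟨r, hr⟩ := this
    exact hα ⟨r, hr.symm⟩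
  rw [GenContFract.terminatedAt_iff_partDen_none] at hnt
  exact Option.ne_none_iff_exists'.mp hnt

/-- `cfCoeff α (i + 1)` is the `i`-th partial denominator of Mathlib's continued fraction. -/
lemma get?_partDens {α : ℝ} (hα : Irrational α) (i : ℕ) :
    (GenContFract.of α).partDens.get? i = some (cfCoeff α (i + 1) : ℝ) := by
  obtain ⟨c, hc⟩ := exists_get?_partDens hα i
  obtain ⟨z, hz⟩ := GenContFract.exists_int_eq_of_partDen hc
  have h1 := GenContFract.of_one_le_get?_partDen hc
  have hz1 : 0 ≤ z := by
    have : (1 : ℝ) ≤ (z : ℝ) := hz ▸ h1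
    have : (1 : ℤ) ≤ z := by exact_mod_cast this
    omega
  lift z to ℕ using hz1
  simp only [cfCoeff, Nat.add_sub_cancel, hc, Option.getD_some, hz]
  simp

lemma one_le_cfCoeff {α : ℝ} (hα : Irrational α) {j : ℕ} (hj : 1 ≤ j) : 1 ≤ cfCoeff α j := by
  obtain ⟨i, rfl⟩ := Nat.exists_eq_add_of_le' hj
  exact_mod_cast GenContFract.of_one_le_get?_partDen (get?_partDens hα i)

/-- `q_{m+1}` is the denominator of the `m`-th convergent in Mathlib's indexing. -/
lemma cfDenom_eq_dens {α : ℝ} (hα : Irrational α) (m : ℕ) :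
    (cfDenom α (m + 1) : ℝ) = (GenContFract.of α).dens m := by
  have key : ∀ i, (GenContFract.of α).s.get? i =
      some ⟨1, (cfCoeff α (i + 1) : ℝ)⟩ := by
    intro i
    obtain ⟨gp, hgp, hb⟩ := GenContFract.exists_s_b_of_partDen (get?_partDens hα i)
    have ha := GenContFract.of_partNum_eq_one (GenContFract.partNum_eq_s_a hgp)
    rw [hgp]
    cases gp
    simp_all
  induction m using Nat.strong_induction_on with
  | _ m ih =>
    match m with
    | 0 => simp [cfDenom]
    | 1 => rw [GenContFract.first_den_eq (key 0)]; simp [cfDenom]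
    | m + 2 =>
      rw [GenContFract.dens_recurrence (key (m + 1)) (ih m (by omega)).symm
        (ih (m + 1) (by omega)).symm]
      rw [cfDenom]
      push_cast
      ring

lemma cfDenom_pos {α : ℝ} (hα : Irrational α) (n : ℕ) : 1 ≤ cfDenom α (n + 1) := by
  induction n with
  | zero => simp [cfDenom]
  | succ n ih =>
    rw [cfDenom]
    nlinarith [one_le_cfCoeff hα (j := n + 1) (by omega), Nat.zero_le (cfDenom α n)]

lemma le_cfDenom {α : ℝ} (hα : Irrational α) (n : ℕ) : n ≤ cfDenom α (n + 1) := by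
  induction n using Nat.strong_induction_on with
  | _ n ih =>
    match n with
    | 0 => simp
    | 1 => exact cfDenom_pos hα 1
    | n + 2 =>
      rw [cfDenom]
      have h1 := one_le_cfCoeff hα (j := n + 2) (by omega)
      have h2 := ih (n + 1) (by omega)
      have h3 := cfDenom_pos hα n
      nlinarith [Nat.mul_le_mul h1 h2]

lemma ostrowskiIndex_spec {α : ℝ} (hα : Irrational α) {N : ℕ} (hN : 1 ≤ N) :
    1 ≤ ostrowskiIndex α N ∧ cfDenom α (ostrowskiIndex α N) ≤ N ∧
      N < cfDenom α (ostrowskiIndex α N + 1) := by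
  have h1 : cfDenom α 1 ≤ N := by simpa [cfDenom] using hN
  refine ⟨Nat.le_findGreatest (by omega) h1,
    Nat.findGreatest_spec (P := fun n => cfDenom α n ≤ N) (by omega : 1 ≤ N + 1) h1, ?_⟩
  by_contra hcon
  push Not at hcon
  have h2 := le_cfDenom hα (ostrowskiIndex α N)
  have h3 : ostrowskiIndex α N + 1 ≤ ostrowskiIndex α N :=
    Nat.le_findGreatest (by omega) hcon
  omega

/-- The digits defined above are those of the Ostrowski expansion. -/
theorem isOstrowski_ostrowskiDigit {α : ℝ} (hα : Irrational α) {N : ℕ} (hN : 1 ≤ N) :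
    IsOstrowski α N (ostrowskiIndex α N) (ostrowskiDigit α N) := by
  obtain ⟨h1, h2, h3⟩ := ostrowskiIndex_spec hα hN
  set n := ostrowskiIndex α N with hn
  have hrem : ∀ j, j ≤ n → ostrowskiRem α N (n - j) < cfDenom α (j + 1) := by
    intro j hj
    rcases Nat.eq_or_lt_of_le hj with rfl | hj
    · simpa [ostrowskiRem] using h3
    · obtain ⟨i, hi⟩ : ∃ i, n - j = i + 1 := ⟨n - j - 1, by omega⟩
      rw [hi, ostrowskiRem, ← hn, show n - i = j + 1 by omega]
      exact Nat.mod_lt _ (cfDenom_pos hα j)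
  have hsum : ∀ j, j ≤ n →
      ∑ i ∈ Finset.Icc 1 j, ostrowskiDigit α N i * cfDenom α i = ostrowskiRem α N (n - j) := by
    intro j
    induction j with
    | zero =>
      intro _
      have := hrem 0 (by omega)
      simp only [cfDenom] at this
      simp
      simp at this
      exact this.symm
    | succ j ih =>
      intro hj
      rw [Finset.sum_Icc_succ_top (by omega), ih (by omega), ostrowskiDigit, ← hn,
        show n - j = (n - (j + 1)) + 1 by omega, ostrowskiRem, ← hn,
        show n - (n - (j + 1)) = j + 1 by omega]
      rw [mul_comm]
      exact Nat.mod_add_div _ _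
  refine ⟨h1, h2, h3, ?_, ?_, ?_⟩
  · intro j hj
    rw [Finset.mem_Icc] at hj
    have h4 := hrem j hj.2
    rw [ostrowskiDigit, ← hn]
    obtain ⟨i, rfl⟩ := Nat.exists_eq_add_of_le' hj.1
    have h5 := cfDenom_pos hα i
    rw [← Nat.lt_succ_iff, Nat.div_lt_iff_lt_mul h5]
    rw [cfDenom] at h4
    have h6 : cfDenom α i ≤ cfDenom α (i + 1) := by
      rcases i with _ | i
      · simp [cfDenom]
      · rw [cfDenom]
        nlinarith [one_le_cfCoeff hα (j := i + 1) (by omega), cfDenom_pos hα i]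
    rw [Nat.succ_mul]
    omega
  · rw [hsum n le_rfl]
    simp [ostrowskiRem]
  · intro J _ hJ
    rw [hsum J hJ.le]
    exact hrem J hJ.le

/-- In every Ostrowski expansion the leading digit is `⌊N / q_n⌋`. -/
lemma IsOstrowski.leading {α : ℝ} (hα : Irrational α) {N n : ℕ} {b : ℕ → ℕ}
    (h : IsOstrowski α N n b) : b n = N / cfDenom α n := by
  obtain ⟨m, rfl⟩ := Nat.exists_eq_add_of_le' h.one_le
  have h1 := cfDenom_pos hα m
  have h2 := h.sum_eq
  rw [Finset.sum_Icc_succ_top (by omega)] at h2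
  have h3 : ∑ j ∈ Finset.Icc 1 m, b j * cfDenom α j < cfDenom α (m + 1) := by
    rcases Nat.eq_zero_or_pos m with rfl | hm
    · simpa using Nat.lt_of_lt_of_le Nat.zero_lt_one h1
    · exact h.partial_lt m hm (by omega)
  symm
  rw [h2, Nat.add_mul_div_right _ _ h1, Nat.div_eq_of_lt h3, zero_add]

/-! ## Trimmed sums over a rotation -/

/-- The rotation `x ↦ x + α (mod 1)` of `[0,1)`. -/
def rotation (α x : ℝ) : ℝ := Int.fract (x + α)

/-- The function `x ↦ x ^ (-β)` on `[0,1)`, with the convention `f 0 = 0` at the singularity. -/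
def powerSing (β x : ℝ) : ℝ := if x = 0 then 0 else x ^ (-β)

/-- The trimmed ergodic sum `S_N^k(f)(x)`: the Birkhoff sum of length `N` minus the largest possible
sum of `k` of its terms; it is `0` if `k > N`. -/
def trimmedSum {X : Type*} (T : X → X) (f : X → ℝ) (N k : ℕ) (x : X) : ℝ :=
  if h : k ≤ N then
    birkhoffSum T f N x -
      ((Finset.range N).powersetCard k).sup'
        (Finset.powersetCard_nonempty.2 (by simpa using h))
        (fun s => ∑ j ∈ s, f (T^[j] x))
  else 0

/-- The trimmed strong law, uniformly on `[0,1)`, with trimming sequence `k` and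
normalisation `d`. -/
def UniformTrimmedStrongLaw (α β : ℝ) (k : ℕ → ℕ) (d : ℕ → ℝ) : Prop :=
  TendstoUniformlyOn (fun N x => trimmedSum (rotation α) (powerSing β) N (k N) x / d N)
    (fun _ => 1) atTop (Set.Ico 0 1)

/-- The trimmed weak law (convergence in Lebesgue measure on `[0,1)`). -/
def TrimmedWeakLaw (α β : ℝ) (k : ℕ → ℕ) (d : ℕ → ℝ) : Prop :=
  ∀ ε : ℝ, 0 < ε → Tendsto
    (fun N => volume {x : ℝ | x ∈ Set.Ico (0 : ℝ) 1 ∧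
      ε < |trimmedSum (rotation α) (powerSing β) N (k N) x / d N - 1|}) atTop (𝓝 0)

/-- `k(N) / max(b_n, max_{j ≤ n-1} a_j) → ∞` as `N → ∞`. -/
def OstrowskiGrowth (α : ℝ) (k : ℕ → ℕ) : Prop :=
  Tendsto (fun N => (k N : ℝ) /
    ((max (ostrowskiDigit α N (ostrowskiIndex α N))
      ((Finset.Ico 1 (ostrowskiIndex α N)).sup (cfCoeff α)) : ℕ) : ℝ)) atTop atTop

/-- The normalisation `N^β k(N)^(1-β) / (β - 1)`. -/
def powerNorm (β : ℝ) (k : ℕ → ℕ) (N : ℕ) : ℝ :=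
  1 / (β - 1) * (N : ℝ) ^ β * (k N : ℝ) ^ (1 - β)

end TrimmedRotation

end

/-! Sufficiency of (III). An orbit of length `q_n` visits every arc `[0,t)` equally often up to an
error 3, because it lies within `1/q_n` of the orbit of the rational rotation by `p_n/q_n`. Cutting
`N` by its Ostrowski digits gives an error at most 3 times the sum of the digits. Only the top
levels need to be cut this way: denominators at least double every two steps, so after `2s+1` levels
fewer than `2^{-s} N` points remain. Each digit used is at most `max(b_n, max_{j<n} a_j)`, so (III)
yields an error `ε(Nt + k)` for all `t` and `x` (`OstrowskiGrowth.eventually_abs_visits_sub_le`).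
Hence the orbit is equidistributed at the scale `k/N`, and the layer cake formula evaluates the sum
of `y^{-β}` over `y ≥ τ` (`abs_sum_filter_rpow_sub_le`). With `τ = (1 ± δ)k/N` there are slightly
more, respectively fewer, than `k` points below `τ`, which traps the trimmed sum
(`OstrowskiGrowth.uniformTrimmedStrongLaw`).

Necessity. If (III) fails, there are infinitely many times `N = b q` (`q` a denominator, `b` at most
about a quarter of the next coefficient) with `k(N) ≤ C b`. With probability at least 1/4 no orbit
point hits the singularity or lies within `1/(4q)` to its left, so moving `x` by `1/(4q)` moves
every orbit point to the right by that amount. At least `b` untrimmed points lie below `(C+4)/q`;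
they carry a fixed proportion of the trimmed sum and shrink by a fixed factor, so the trimmed sum
drops by a factor independent of `N` (`trimmedSum_le_dropFactor_mul`). No normalisation is
compatible with both values.

The assertions on `d_N` follow since two normalisations of one weak law are asymptotically equal. -/

noncomputable section

namespace TrimmedRotation

/-! ## Convergents -/

/-- The numerators `p_n` belonging to the denominators `q_n`. -/
def cfNum (α : ℝ) : ℕ → ℤ
  | 0 => 1
  | 1 => 0
  | n + 2 => cfCoeff α (n + 1) * cfNum α (n + 1) + cfNum α n

lemma get?_s {α : ℝ} (hα : Irrational α) (i : ℕ) :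
    (GenContFract.of α).s.get? i = some ⟨1, (cfCoeff α (i + 1) : ℝ)⟩ := by
  obtain ⟨gp, hgp, hb⟩ := GenContFract.exists_s_b_of_partDen (get?_partDens hα i)
  have ha := GenContFract.of_partNum_eq_one (GenContFract.partNum_eq_s_a hgp)
  rw [hgp]
  cases gp
  simp_all

lemma cfNum_eq_nums {α : ℝ} (hα : Irrational α) (hα01 : α ∈ Set.Ioo (0 : ℝ) 1) (m : ℕ) :
    (cfNum α (m + 1) : ℝ) = (GenContFract.of α).nums m := by
  have h0 : (GenContFract.of α).h = 0 := by
    rw [GenContFract.of_h_eq_floor, Int.floor_eq_zero_iff.2 ⟨hα01.1.le, hα01.2⟩, Int.cast_zero]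
  induction m using Nat.strong_induction_on with
  | _ m ih =>
    match m with
    | 0 => rw [GenContFract.zeroth_num_eq_h, h0]; simp [cfNum]
    | 1 => rw [GenContFract.first_num_eq (get?_s hα 0), h0]; simp [cfNum]
    | m + 2 =>
      rw [GenContFract.nums_recurrence (get?_s hα (m + 1)) (ih m (by omega)).symm
        (ih (m + 1) (by omega)).symm]
      rw [cfNum]
      push_cast
      ring

lemma cfNum_mul_cfDenom_sub (α : ℝ) (n : ℕ) :
    cfNum α n * cfDenom α (n + 1) - cfNum α (n + 1) * cfDenom α n = (-1) ^ n := by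
  induction n with
  | zero => simp [cfNum, cfDenom]
  | succ n ih =>
    rw [cfNum, cfDenom, pow_succ, ← ih]
    push_cast
    ring

lemma isCoprime_cfNum_cfDenom (α : ℝ) (n : ℕ) :
    IsCoprime (cfNum α (n + 1)) (cfDenom α (n + 1) : ℤ) := by
  have h := cfNum_mul_cfDenom_sub α n
  rcases neg_one_pow_eq_or ℤ n with h1 | h1
  · exact ⟨-cfDenom α n, cfNum α n, by rw [← h1, ← h]; ring⟩
  · exact ⟨cfDenom α n, -cfNum α n, by rw [← neg_neg (1 : ℤ), ← h1, ← h]; ring⟩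

lemma abs_cfDenom_mul_sub_cfNum_le {α : ℝ} (hα : Irrational α) (hα01 : α ∈ Set.Ioo (0 : ℝ) 1)
    (n : ℕ) :
    |cfDenom α (n + 1) * α - cfNum α (n + 1)| ≤ 1 / cfDenom α (n + 2) := by
  have hnt : ¬ (GenContFract.of α).TerminatedAt n := by
    rw [GenContFract.terminatedAt_iff_s_none, get?_s hα]
    simp
  have h := GenContFract.abs_sub_convs_le hnt
  rw [GenContFract.conv_eq_num_div_den, ← cfNum_eq_nums hα hα01, ← cfDenom_eq_dens hα,
    ← cfDenom_eq_dens hα] at h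
  have hq : (0 : ℝ) < cfDenom α (n + 1) := by exact_mod_cast cfDenom_pos hα n
  have e : (cfDenom α (n + 1) * α - cfNum α (n + 1) : ℝ) =
      cfDenom α (n + 1) * (α - cfNum α (n + 1) / cfDenom α (n + 1)) := by
    field_simp
  rw [e, abs_mul, abs_of_pos hq]
  refine (mul_le_mul_of_nonneg_left h hq.le).trans (le_of_eq ?_)
  field_simp

lemma cfDenom_le_succ {α : ℝ} (hα : Irrational α) (n : ℕ) :
    cfDenom α n ≤ cfDenom α (n + 1) := by
  rcases n with _ | n
  · simp [cfDenom]
  · rw [cfDenom]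
    nlinarith [one_le_cfCoeff hα (j := n + 1) (by omega), cfDenom_pos hα n]

lemma cfDenom_mono {α : ℝ} (hα : Irrational α) : Monotone (cfDenom α) :=
  monotone_nat_of_le_succ (cfDenom_le_succ hα)

lemma cfCoeff_mul_cfDenom_le (α : ℝ) {n : ℕ} (hn : 1 ≤ n) :
    cfCoeff α n * cfDenom α n ≤ cfDenom α (n + 1) := by
  obtain ⟨m, rfl⟩ := Nat.exists_eq_add_of_le' hn
  rw [cfDenom]
  omega

/-- Two steps of the recursion at least double: `q_{m+2} ≥ q_{m+1} + q_m ≥ 2 q_m`. -/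
lemma two_pow_mul_cfDenom_le {α : ℝ} (hα : Irrational α) (m s : ℕ) :
    2 ^ s * cfDenom α m ≤ cfDenom α (m + 2 * s) := by
  induction s with
  | zero => simp
  | succ s ih =>
    rw [show m + 2 * (s + 1) = m + 2 * s + 2 by ring, cfDenom, pow_succ]
    have h1 := one_le_cfCoeff hα (j := m + 2 * s + 1) (by omega)
    have h2 := cfDenom_le_succ hα (m + 2 * s)
    nlinarith

/-! ## Counting orbit points in an interval -/

/-- The number of `m < N` for which the fractional part of `x + m α` lies in `[0, t)`, for
`0 ≤ t ≤ 1`. -/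
def visits (α x t : ℝ) (N : ℕ) : ℤ :=
  ∑ m ∈ Finset.range N, (⌊x + m * α⌋ - ⌊x + m * α - t⌋)

lemma floor_sub_floor_sub {y t : ℝ} (ht : 0 ≤ t) (ht1 : t ≤ 1) :
    ⌊y⌋ - ⌊y - t⌋ = if Int.fract y < t then 1 else 0 := by
  have h1 := Int.floor_add_fract y
  have h2 := Int.fract_nonneg y
  have h3 := Int.fract_lt_one y
  split_ifs with h
  · rw [show ⌊y - t⌋ = ⌊y⌋ - 1 from Int.floor_eq_iff.2 ⟨by push_cast; linarith,
      by push_cast; linarith⟩]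
    ring
  · rw [show ⌊y - t⌋ = ⌊y⌋ from Int.floor_eq_iff.2 ⟨by linarith [not_lt.1 h],
      by linarith⟩]
    ring

lemma visits_eq_card {α x t : ℝ} (ht : 0 ≤ t) (ht1 : t ≤ 1) (N : ℕ) :
    visits α x t N = ((Finset.range N).filter (fun m : ℕ => Int.fract (x + m * α) < t)).card := by
  simp only [visits, floor_sub_floor_sub ht ht1, Finset.card_filter]
  push_cast
  rfl

lemma visits_add (α x t : ℝ) (M N : ℕ) :
    visits α x t (M + N) = visits α x t M + visits α (x + M * α) t N := by
  simp only [visits, Finset.sum_range_add]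
  congr 1
  refine Finset.sum_congr rfl fun m _ => ?_
  push_cast
  ring_nf

lemma visits_nonneg {α x t : ℝ} (ht : 0 ≤ t) (N : ℕ) : 0 ≤ visits α x t N :=
  Finset.sum_nonneg fun _ _ => sub_nonneg.2 (Int.floor_le_floor (by linarith))

lemma visits_mono {α x t : ℝ} (ht : 0 ≤ t) : Monotone (visits α x t) :=
  fun _ _ h => Finset.sum_le_sum_of_subset_of_nonneg (Finset.range_mono h)
    fun _ _ _ => sub_nonneg.2 (Int.floor_le_floor (by linarith))

/-- As `p` is invertible mod `q`, the map `m ↦ s + m p` permutes the residues. -/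
lemma sum_emod_range {p : ℤ} {q : ℕ} (hq : 0 < q) (hpq : IsCoprime p q) (s : ℤ) :
    ∑ m ∈ Finset.range q, (s + m * p) % q = ∑ m ∈ Finset.range q, (m : ℤ) := by
  have hq' : (0 : ℤ) < q := by exact_mod_cast hq
  have hinj : Set.InjOn (fun m : ℕ => ((s + m * p) % q).toNat) (Finset.range q) := by
    intro a ha b hb hab
    have h1 : (s + a * p) % q = (s + b * p) % q := by
      have ha0 := Int.emod_nonneg (s + a * p) hq'.ne'
      have hb0 := Int.emod_nonneg (s + b * p) hq'.ne'
      simp only at hab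
      omega
    have h2 : (q : ℤ) ∣ (a - b) * p := by
      have h3 := Int.ModEq.dvd (show (s + b * p) ≡ (s + a * p) [ZMOD q] from h1.symm)
      rwa [show s + a * p - (s + b * p) = (a - b) * p by ring] at h3
    have h3 : (q : ℤ) ∣ a - b := hpq.symm.dvd_of_dvd_mul_right h2
    have h4 : |(a - b : ℤ)| < q := by
      simp only [Finset.coe_range, Set.mem_Iio] at ha hb
      rw [abs_lt]
      constructor <;> omega
    have h5 := Int.eq_zero_of_abs_lt_dvd h3 h4
    omega
  have himg : (Finset.range q).image (fun m : ℕ => ((s + m * p) % q).toNat) = Finset.range q := by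
    refine Finset.eq_of_subset_of_card_le ?_ ?_
    · intro i hi
      obtain ⟨m, _, rfl⟩ := Finset.mem_image.1 hi
      have h1 := Int.emod_lt_of_pos (s + m * p) hq'
      have h2 := Int.emod_nonneg (s + m * p) hq'.ne'
      rw [Finset.mem_range]
      omega
    · rw [Finset.card_image_of_injOn hinj]
  conv_rhs => rw [← himg]
  rw [Finset.sum_image hinj]
  refine Finset.sum_congr rfl fun m _ => ?_
  rw [Int.toNat_of_nonneg (Int.emod_nonneg _ hq'.ne')]

/-- `∑_{m < q} ⌊y + m p / q⌋` is `⌊q y⌋` up to a constant. -/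
lemma sum_floor_add_div {p : ℤ} {q : ℕ} (hq : 0 < q) (hpq : IsCoprime p q) (y : ℝ) :
    ∑ m ∈ Finset.range q, ⌊y + m * p / q⌋ =
      ⌊q * y⌋ + ∑ m ∈ Finset.range q, ⌊(m * p / q : ℝ)⌋ := by
  have hq' : (0 : ℤ) < q := by exact_mod_cast hq
  have hqr : (0 : ℝ) < q := by exact_mod_cast hq
  have h1 : ∀ z : ℝ, ∀ m : ℕ, ⌊z + m * p / q⌋ = (⌊q * z⌋ + m * p) / (q : ℤ) := by
    intro z m
    have e : z + m * p / q = (q * z + (m * p : ℤ)) / q := by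
      push_cast
      field_simp
    rw [e]
    have := Int.floor_div_natCast (q * z + (m * p : ℤ)) q
    rw [this, Int.floor_add_intCast]
  -- Each quotient is (number − residue)/q, and the sum of the residues does not depend on `s`.
  have h2 : ∀ s : ℤ, q * ∑ m ∈ Finset.range q, (s + m * p) / (q : ℤ) =
      q * s + (∑ m ∈ Finset.range q, (m * p : ℤ) - ∑ m ∈ Finset.range q, (m : ℤ)) := by
    intro s
    have h3 := sum_emod_range hq hpq s
    have h4 : ∑ m ∈ Finset.range q, (s + m * p) =
        ∑ m ∈ Finset.range q, ((s + m * p) % q + q * ((s + m * p) / q)) :=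
      Finset.sum_congr rfl fun m _ => (Int.emod_add_mul_ediv _ _).symm
    rw [Finset.sum_add_distrib, Finset.sum_add_distrib, h3, ← Finset.mul_sum, Finset.sum_const,
      Finset.card_range, nsmul_eq_mul] at h4
    linarith
  have h5 : ∑ m ∈ Finset.range q, ⌊(m * p / q : ℝ)⌋ =
      ∑ m ∈ Finset.range q, (0 + m * p) / (q : ℤ) := by
    refine Finset.sum_congr rfl fun m _ => ?_
    have := h1 0 m
    simpa using this
  rw [h5]
  simp only [h1 y]
  have h6 := h2 ⌊q * y⌋
  have h7 := h2 0
  refine mul_left_cancel₀ hq'.ne' ?_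
  rw [mul_add, h6, h7]
  ring

/-- A rotation orbit of length `q_n` is equidistributed up to a bounded error. -/
lemma abs_visits_cfDenom_sub_le {α : ℝ} (hα : Irrational α) (hα01 : α ∈ Set.Ioo (0 : ℝ) 1)
    (n : ℕ) (x t : ℝ) :
    |(visits α x t (cfDenom α (n + 1)) : ℝ) - cfDenom α (n + 1) * t| ≤ 3 := by
  set q := cfDenom α (n + 1) with hqdef
  set p := cfNum α (n + 1) with hpdef
  have hq : 0 < q := cfDenom_pos hα n
  have hqr : (0 : ℝ) < q := by exact_mod_cast hq
  have hpq : IsCoprime p (q : ℤ) := isCoprime_cfNum_cfDenom α n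
  have happ : |q * α - p| ≤ 1 / q := by
    refine (abs_cfDenom_mul_sub_cfNum_le hα hα01 n).trans ?_
    exact one_div_le_one_div_of_le hqr (by exact_mod_cast cfDenom_le_succ hα (n + 1))
  have hdist : ∀ m ∈ Finset.range q, |(m * α - m * p / q : ℝ)| ≤ 1 / q := by
    intro m hm
    have hmq : (m : ℝ) ≤ q := by exact_mod_cast (Finset.mem_range.1 hm).le
    have e : (m * α - m * p / q : ℝ) = m / q * (q * α - p) := by
      field_simp
    rw [e, abs_mul, abs_of_nonneg (by positivity)]
    calc (m / q : ℝ) * |q * α - p| ≤ 1 * (1 / q) := by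
          gcongr
          rw [div_le_one hqr]
          exact hmq
      _ = 1 / q := one_mul _
  set C := ∑ m ∈ Finset.range q, ⌊(m * p / q : ℝ)⌋ with hC
  -- Replacing `mα` by `m p/q` costs at most `1/q`, and shifting `y` by `1/q` changes `⌊q y⌋` by
  -- exactly 1. In the difference at `x` and `x - t` the constant `C` cancels, leaving an error 1 +
  -- 1 from here and less than 1 from the two floors.
  have key : ∀ y : ℝ, ⌊q * y⌋ + C - 1 ≤ ∑ m ∈ Finset.range q, ⌊y + m * α⌋ ∧
      ∑ m ∈ Finset.range q, ⌊y + m * α⌋ ≤ ⌊q * y⌋ + C + 1 := by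
    intro y
    constructor
    · have h1 := sum_floor_add_div hq hpq (y - 1 / q)
      rw [show q * (y - 1 / q) = q * y - 1 by field_simp, Int.floor_sub_one, ← hC] at h1
      have h2 : ∑ m ∈ Finset.range q, ⌊y - 1 / q + m * p / q⌋ ≤
          ∑ m ∈ Finset.range q, ⌊y + m * α⌋ := by
        refine Finset.sum_le_sum fun m hm => Int.floor_le_floor ?_
        linarith [(abs_le.1 (hdist m hm)).1]
      linarith
    · have h1 := sum_floor_add_div hq hpq (y + 1 / q)
      rw [show q * (y + 1 / q) = q * y + 1 by field_simp, Int.floor_add_one, ← hC] at h1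
      have h2 : ∑ m ∈ Finset.range q, ⌊y + m * α⌋ ≤
          ∑ m ∈ Finset.range q, ⌊y + 1 / q + m * p / q⌋ := by
        refine Finset.sum_le_sum fun m hm => Int.floor_le_floor ?_
        linarith [(abs_le.1 (hdist m hm)).2]
      linarith
  have hv : visits α x t q = ∑ m ∈ Finset.range q, ⌊x + m * α⌋ -
      ∑ m ∈ Finset.range q, ⌊x - t + m * α⌋ := by
    rw [visits, Finset.sum_sub_distrib]
    congr 1
    refine Finset.sum_congr rfl fun m _ => ?_
    ring_nf
  have h1 := key x
  have h2 := key (x - t)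
  have h3 : visits α x t q ≤ ⌊q * x⌋ - ⌊q * (x - t)⌋ + 2 := by linarith
  have h4 : ⌊q * x⌋ - ⌊q * (x - t)⌋ - 2 ≤ visits α x t q := by linarith
  have h3' : (visits α x t q : ℝ) ≤ ⌊q * x⌋ - ⌊q * (x - t)⌋ + 2 := by exact_mod_cast h3
  have h4' : (⌊q * x⌋ - ⌊q * (x - t)⌋ - 2 : ℝ) ≤ visits α x t q := by exact_mod_cast h4
  have f1 := Int.floor_le (q * x)
  have f2 := Int.lt_floor_add_one (q * x)
  have f3 := Int.floor_le (q * (x - t))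
  have f4 := Int.lt_floor_add_one (q * (x - t))
  rw [abs_le]
  constructor <;> nlinarith

lemma abs_visits_mul_cfDenom_sub_le {α : ℝ} (hα : Irrational α) (hα01 : α ∈ Set.Ioo (0 : ℝ) 1)
    (n b : ℕ) (x t : ℝ) :
    |(visits α x t (b * cfDenom α (n + 1)) : ℝ) - (b * cfDenom α (n + 1) : ℕ) * t| ≤ 3 * b := by
  induction b with
  | zero => simp [visits]
  | succ b ih =>
    rw [add_mul, one_mul, visits_add]
    have h := abs_visits_cfDenom_sub_le hα hα01 n (x + (b * cfDenom α (n + 1) : ℕ) * α) t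
    push_cast at *
    rw [abs_le] at *
    constructor <;> linarith

/-- One step of the Ostrowski algorithm: full blocks of length `q_{n+1}` cost 3 each. The remainder
starts at a shifted point, so its bound is needed for all starting points. -/
lemma abs_visits_sub_le_of_mod {α : ℝ} (hα : Irrational α) (hα01 : α ∈ Set.Ioo (0 : ℝ) 1)
    (n N : ℕ) (t E : ℝ)
    (h : ∀ x, |(visits α x t (N % cfDenom α (n + 1)) : ℝ) - (N % cfDenom α (n + 1) : ℕ) * t| ≤ E)
    (x : ℝ) :
    |(visits α x t N : ℝ) - N * t| ≤ 3 * (N / cfDenom α (n + 1) : ℕ) + E := by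
  have e : N / cfDenom α (n + 1) * cfDenom α (n + 1) + N % cfDenom α (n + 1) = N :=
    Nat.div_add_mod' _ _
  have e' : ((N / cfDenom α (n + 1) * cfDenom α (n + 1) : ℕ) : ℝ) +
    (N % cfDenom α (n + 1) : ℕ) = N := by exact_mod_cast e
  have h1 := abs_visits_mul_cfDenom_sub_le hα hα01 n (N / cfDenom α (n + 1)) x t
  have h2 := h (x + (N / cfDenom α (n + 1) * cfDenom α (n + 1) : ℕ) * α)
  have h3 := visits_add α x t (N / cfDenom α (n + 1) * cfDenom α (n + 1)) (N % cfDenom α (n + 1))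
  rw [e] at h3
  rw [h3, ← e']
  rw [abs_le] at *
  push_cast at *
  constructor <;> linarith

/-- Only `r` levels are cut off. The fewer than `q_{m+1}` points left over are compared, by
monotonicity in the length, with one full block. -/
lemma abs_visits_sub_le {α : ℝ} (hα : Irrational α) (hα01 : α ∈ Set.Ioo (0 : ℝ) 1)
    {t : ℝ} (ht : 0 ≤ t) (m A r : ℕ)
    (hA : ∀ j, m + 1 ≤ j → j < m + 1 + r → cfCoeff α j ≤ A)
    (N : ℕ) (hN : N < cfDenom α (m + 1 + r)) (x : ℝ) :
    |(visits α x t N : ℝ) - N * t| ≤ 3 * r * A + (cfDenom α (m + 1) * t + 3) := by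
  induction r generalizing N x with
  | zero =>
    have h1 := abs_visits_cfDenom_sub_le hα hα01 m x t
    have h2 : (visits α x t N : ℝ) ≤ visits α x t (cfDenom α (m + 1)) := by
      exact_mod_cast visits_mono ht hN.le
    have h3 : (0 : ℝ) ≤ visits α x t N := by exact_mod_cast visits_nonneg ht N
    have h4 : (N : ℝ) * t ≤ cfDenom α (m + 1) * t := by
      have : (N : ℝ) ≤ cfDenom α (m + 1) := by exact_mod_cast hN.le
      gcongr
    have h5 : (0 : ℝ) ≤ N * t := by positivity
    rw [abs_le] at *
    constructor <;> push_cast <;> linarith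
  | succ r ih =>
    have hpos : 0 < cfDenom α (m + r + 1) := cfDenom_pos hα _
    -- With `j = m + r + 1`, `N < q_{j+1} = a_j q_j + q_{j-1} ≤ (a_j + 1) q_j`.
    have h1 : N / cfDenom α (m + r + 1) ≤ A := by
      refine le_trans ?_ (hA (m + r + 1) (by omega) (by omega))
      rw [← Nat.lt_succ_iff, Nat.div_lt_iff_lt_mul hpos, Nat.succ_mul]
      rw [show m + 1 + (r + 1) = m + r + 2 by ring, cfDenom] at hN
      have := cfDenom_le_succ hα (m + r)
      omega
    have h2 := abs_visits_sub_le_of_mod hα hα01 (m + r) N t _ (fun y =>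
      ih (fun j hj hj' => hA j hj (by omega)) (N % cfDenom α (m + r + 1))
        (by rw [show m + 1 + r = m + r + 1 by ring]; exact Nat.mod_lt _ hpos) y) x
    have h3 : ((N / cfDenom α (m + r + 1) : ℕ) : ℝ) ≤ A := by exact_mod_cast h1
    push_cast at *
    linarith

/-! ### The leading Ostrowski digit and equidistribution at the scale `k(N)/N` -/

lemma tendsto_ostrowskiIndex (α : ℝ) :
    Tendsto (ostrowskiIndex α) atTop atTop := by
  refine tendsto_atTop.2 fun M => ?_
  filter_upwards [eventually_ge_atTop (cfDenom α M + M)] with N hN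
  exact Nat.le_findGreatest (by omega) (by omega)

lemma ostrowskiDigit_index (α : ℝ) (N : ℕ) :
    ostrowskiDigit α N (ostrowskiIndex α N) = N / cfDenom α (ostrowskiIndex α N) := by
  simp [ostrowskiDigit, ostrowskiRem]

lemma one_le_ostrowskiDigit_index {α : ℝ} (hα : Irrational α) {N : ℕ} (hN : 1 ≤ N) :
    1 ≤ ostrowskiDigit α N (ostrowskiIndex α N) := by
  obtain ⟨h1, h2, -⟩ := ostrowskiIndex_spec hα hN
  rw [ostrowskiDigit_index]
  obtain ⟨m, hm⟩ := Nat.exists_eq_add_of_le' h1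
  exact Nat.div_pos h2 (hm ▸ cfDenom_pos hα m)

lemma ostrowskiDigit_index_le {α : ℝ} (hα : Irrational α) {N : ℕ} (hN : 1 ≤ N) :
    ostrowskiDigit α N (ostrowskiIndex α N) ≤ cfCoeff α (ostrowskiIndex α N) :=
  (isOstrowski_ostrowskiDigit hα hN).digit_le _
    (Finset.mem_Icc.2 ⟨(ostrowskiIndex_spec hα hN).1, le_rfl⟩)

/-- Under the growth condition the orbit is equidistributed at the scale `k(N) / N`. -/
lemma OstrowskiGrowth.eventually_abs_visits_sub_le {α : ℝ} (hα : Irrational α)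
    (hα01 : α ∈ Set.Ioo (0 : ℝ) 1) {k : ℕ → ℕ} (hg : OstrowskiGrowth α k) {ε : ℝ} (hε : 0 < ε) :
    ∀ᶠ N : ℕ in atTop, ∀ x t : ℝ, 0 ≤ t →
      |(visits α x t N : ℝ) - N * t| ≤ ε * (N * t + k N) := by
  obtain ⟨s, hs⟩ := exists_pow_lt_of_lt_one hε (by norm_num : (1 / 2 : ℝ) < 1)
  -- The constant `6s + 6` collects `3b` from the leading level, `3·2s·A` from the next `2s` levels
  -- and a final 3, where `b ≤ A` and `1 ≤ A`.
  filter_upwards [(tendsto_ostrowskiIndex α).eventually_ge_atTop (2 * s + 1),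
    hg.eventually_ge_atTop ((6 * s + 6) / ε), eventually_ge_atTop 1] with N hn hk hN x t ht
  obtain ⟨h1, h2, h3⟩ := ostrowskiIndex_spec hα hN
  have hb1 := one_le_ostrowskiDigit_index hα hN
  have hbeq := ostrowskiDigit_index α N
  set n := ostrowskiIndex α N with hndef
  set b := ostrowskiDigit α N n with hbdef
  set A := max b ((Finset.Ico 1 n).sup (cfCoeff α)) with hAdef
  have hbA : b ≤ A := le_max_left _ _
  have hA0 : (1 : ℝ) ≤ A := by exact_mod_cast hb1.trans hbA
  obtain ⟨m, hm⟩ : ∃ m, n = m + 1 + 2 * s := ⟨n - 1 - 2 * s, by omega⟩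
  have hm' : n = m + 2 * s + 1 := by omega
  -- The level `n` is cut separately: its digit is `b`, whereas `a_n` itself need not be bounded by
  -- `A`.
  have herr := abs_visits_sub_le_of_mod hα hα01 (m + 2 * s) N t _ (fun y =>
    abs_visits_sub_le hα hα01 ht m A (2 * s)
      (fun j hj hj' => (Finset.le_sup (f := cfCoeff α)
        (Finset.mem_Ico.2 ⟨by omega, by omega⟩)).trans (le_max_right _ _))
      (N % cfDenom α (m + 2 * s + 1))
      (by rw [show m + 1 + 2 * s = m + 2 * s + 1 by ring]
          exact Nat.mod_lt _ (cfDenom_pos hα _)) y) x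
  rw [← hm', ← hbeq] at herr
  have hq : (2 : ℝ) ^ s * cfDenom α (m + 1) ≤ N := by
    exact_mod_cast (two_pow_mul_cfDenom_le hα (m + 1) s).trans (by rw [← hm]; exact h2)
  have hq' : (cfDenom α (m + 1) : ℝ) ≤ ε * N := by
    calc (cfDenom α (m + 1) : ℝ) = (1 / 2) ^ s * (2 ^ s * cfDenom α (m + 1)) := by
          rw [← mul_assoc, ← mul_pow]; norm_num
      _ ≤ ε * N := mul_le_mul hs.le hq (by positivity) hε.le
  rw [le_div_iff₀ (by linarith), div_mul_eq_mul_div, div_le_iff₀ hε] at hk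
  have hbA' : (b : ℝ) ≤ A := by exact_mod_cast hbA
  have h4 : (cfDenom α (m + 1) : ℝ) * t ≤ ε * N * t := by gcongr
  push_cast at herr
  refine herr.trans ?_
  nlinarith

/-! ## Orbits and trimmed sums -/

lemma rotation_iterate (α : ℝ) {x : ℝ} (hx : x ∈ Set.Ico (0 : ℝ) 1) (m : ℕ) :
    (rotation α)^[m] x = Int.fract (x + m * α) := by
  induction m with
  | zero => simp [Int.fract_eq_self.2 hx]
  | succ m ih =>
    rw [Function.iterate_succ_apply', ih, rotation, Int.fract_eq_fract]
    refine ⟨-⌊x + m * α⌋, ?_⟩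
    rw [Int.fract]
    push_cast
    ring

lemma powerSing_nonneg {β x : ℝ} (hx : 0 ≤ x) : 0 ≤ powerSing β x := by
  unfold powerSing
  split_ifs
  · exact le_rfl
  · positivity

lemma powerSing_of_pos {β x : ℝ} (hx : 0 < x) : powerSing β x = x ^ (-β) :=
  if_neg hx.ne'

section Trimmed

variable {X : Type*} {T : X → X} {f : X → ℝ} {N k : ℕ} {x : X}

lemma trimmedSum_le_sum_sdiff {s : Finset ℕ} (hs : s ⊆ Finset.range N) (hsk : s.card = k) :
    trimmedSum T f N k x ≤ ∑ j ∈ Finset.range N \ s, f (T^[j] x) := by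
  have hk : k ≤ N := by simpa [hsk] using Finset.card_le_card hs
  rw [trimmedSum, dif_pos hk, birkhoffSum, ← Finset.sum_sdiff hs]
  have := Finset.le_sup' (fun s : Finset ℕ => ∑ j ∈ s, f (T^[j] x))
    (Finset.mem_powersetCard.2 ⟨hs, hsk⟩)
  linarith

lemma exists_trimmedSum_eq (hk : k ≤ N) : ∃ s ⊆ Finset.range N, s.card = k ∧
    trimmedSum T f N k x = ∑ j ∈ Finset.range N \ s, f (T^[j] x) := by
  obtain ⟨s, hs, hsup⟩ := Finset.exists_mem_eq_sup'
    (Finset.powersetCard_nonempty.2 (by simpa using hk) :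
      ((Finset.range N).powersetCard k).Nonempty)
    (fun s : Finset ℕ => ∑ j ∈ s, f (T^[j] x))
  obtain ⟨hs1, hs2⟩ := Finset.mem_powersetCard.1 hs
  refine ⟨s, hs1, hs2, ?_⟩
  rw [trimmedSum, dif_pos hk, hsup, birkhoffSum, ← Finset.sum_sdiff hs1]
  ring

end Trimmed

/-- Removing a set `B` of largest terms leaves the least sum. -/
lemma sum_sdiff_le_sum_sdiff_of_threshold {ι : Type*} [DecidableEq ι] {R B s : Finset ι}
    {f : ι → ℝ} {v : ℝ} (hv : 0 ≤ v) (hB : B ⊆ R) (hs : s ⊆ R) (hcard : s.card ≤ B.card)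
    (hge : ∀ i ∈ B, v ≤ f i) (hle : ∀ i ∈ R \ B, f i ≤ v) :
    ∑ i ∈ R \ B, f i ≤ ∑ i ∈ R \ s, f i := by
  have e1 : R \ B = (R \ (B ∪ s)) ∪ (s \ B) := by
    ext i
    have := @hs i
    simp only [Finset.mem_sdiff, Finset.mem_union]
    tauto
  have e2 : R \ s = (R \ (B ∪ s)) ∪ (B \ s) := by
    ext i
    have := @hB i
    simp only [Finset.mem_sdiff, Finset.mem_union]
    tauto
  have d1 : Disjoint (R \ (B ∪ s)) (s \ B) := by
    rw [Finset.disjoint_left]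
    simp only [Finset.mem_sdiff, Finset.mem_union]
    tauto
  have d2 : Disjoint (R \ (B ∪ s)) (B \ s) := by
    rw [Finset.disjoint_left]
    simp only [Finset.mem_sdiff, Finset.mem_union]
    tauto
  have hc : (s \ B).card ≤ (B \ s).card := by
    have h1 := Finset.card_sdiff_add_card_inter s B
    have h2 := Finset.card_sdiff_add_card_inter B s
    rw [Finset.inter_comm] at h2
    omega
  have h1 : ∑ i ∈ s \ B, f i ≤ (s \ B).card * v := by
    rw [← nsmul_eq_mul]
    exact Finset.sum_le_card_nsmul _ _ _ fun i hi =>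
      hle i (Finset.mem_sdiff.2 ⟨hs (Finset.mem_sdiff.1 hi).1, (Finset.mem_sdiff.1 hi).2⟩)
  have h2 : (B \ s).card * v ≤ ∑ i ∈ B \ s, f i := by
    rw [← nsmul_eq_mul]
    exact Finset.card_nsmul_le_sum _ _ _ fun i hi => hge i (Finset.mem_sdiff.1 hi).1
  have h3 : ((s \ B).card : ℝ) * v ≤ (B \ s).card * v := by gcongr
  rw [e1, e2, Finset.sum_union d1, Finset.sum_union d2]
  linarith

lemma fract_add_mul_injective {α : ℝ} (hα : Irrational α) (x : ℝ) :
    Function.Injective fun m : ℕ => Int.fract (x + m * α) := by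
  intro m m' h
  obtain ⟨z, hz⟩ := Int.fract_eq_fract.1 h
  by_contra hne
  have h1 : ((m : ℤ) - m' : ℤ) ≠ 0 := by omega
  have h2 := hα.intCast_mul h1
  refine h2.ne_int z ?_
  push_cast
  linarith

section Sandwich

variable {α β : ℝ} {k N : ℕ} {x t : ℝ}

/-- The at most `k` points below `t` can all be put into a set of `k` trimmed terms. -/
lemma trimmedSum_le_sum_filter (hx : x ∈ Set.Ico (0 : ℝ) 1) (hk : k ≤ N) (ht : 0 ≤ t) (ht1 : t ≤ 1)
    (hc : visits α x t N ≤ k) :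
    trimmedSum (rotation α) (powerSing β) N k x ≤
      ∑ m ∈ (Finset.range N).filter (fun m : ℕ => t ≤ Int.fract (x + m * α)),
        powerSing β (Int.fract (x + m * α)) := by
  rw [visits_eq_card ht ht1] at hc
  obtain ⟨s, hs1, hs2, hs3⟩ := Finset.exists_subsuperset_card_eq
    (Finset.filter_subset (fun m : ℕ => Int.fract (x + m * α) < t) (Finset.range N))
    (by exact_mod_cast hc) (by simpa using hk)
  refine (trimmedSum_le_sum_sdiff hs2 hs3).trans ?_
  simp only [rotation_iterate α hx]
  refine Finset.sum_le_sum_of_subset_of_nonneg (fun m hm => ?_)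
    fun _ _ _ => powerSing_nonneg (Int.fract_nonneg _)
  rw [Finset.mem_sdiff] at hm
  refine Finset.mem_filter.2 ⟨hm.1, not_lt.1 fun h => hm.2 (hs1 (Finset.mem_filter.2 ⟨hm.1, h⟩))⟩

/-- One visit more than `k` is required because a single orbit point may be 0, where `powerSing`
vanishes instead of being large; injectivity of the orbit excludes a second one. -/
lemma sum_filter_le_trimmedSum (hα : Irrational α) (hβ : 0 ≤ β) (hx : x ∈ Set.Ico (0 : ℝ) 1)
    (hk : k ≤ N) (ht : 0 < t) (ht1 : t ≤ 1) (hc : (k + 1 : ℤ) ≤ visits α x t N) :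
    ∑ m ∈ (Finset.range N).filter (fun m : ℕ => t ≤ Int.fract (x + m * α)),
        powerSing β (Int.fract (x + m * α)) ≤
      trimmedSum (rotation α) (powerSing β) N k x := by
  rw [visits_eq_card ht.le ht1] at hc
  obtain ⟨s, hs1, hs2, hs3⟩ := exists_trimmedSum_eq (T := rotation α) (f := powerSing β)
    (x := x) hk
  rw [hs3]
  simp only [rotation_iterate α hx]
  set y : ℕ → ℝ := fun m => Int.fract (x + m * α) with hy
  have hy0 : ∀ m, 0 ≤ y m := fun m => Int.fract_nonneg _
  have hinj : Function.Injective y := fract_add_mul_injective hα x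
  set B := (Finset.range N).filter (fun m => y m < t ∧ y m ≠ 0) with hBdef
  have hBcard : s.card ≤ B.card := by
    have h1 : (Finset.range N).filter (fun m => y m < t) ⊆
        B ∪ (Finset.range N).filter (fun m => y m = 0) := by
      intro m
      simp only [hBdef, Finset.mem_union, Finset.mem_filter]
      tauto
    have h2 : ((Finset.range N).filter (fun m => y m = 0)).card ≤ 1 := by
      rw [Finset.card_le_one]
      intro a ha b hb
      exact hinj ((Finset.mem_filter.1 ha).2.trans (Finset.mem_filter.1 hb).2.symm)
    have h3 := (Finset.card_le_card h1).trans (Finset.card_union_le _ _)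
    have h4 : k + 1 ≤ ((Finset.range N).filter (fun m => y m < t)).card := by exact_mod_cast hc
    omega
  have hv : (0 : ℝ) ≤ t ^ (-β) := by positivity
  refine le_trans ?_ (sum_sdiff_le_sum_sdiff_of_threshold hv (Finset.filter_subset _ _) hs1 hBcard
    (fun m hm => ?_) (fun m hm => ?_))
  · refine Finset.sum_le_sum_of_subset_of_nonneg (fun m hm => ?_)
      fun m _ _ => powerSing_nonneg (hy0 m)
    rw [Finset.mem_filter] at hm
    refine Finset.mem_sdiff.2 ⟨hm.1, fun h => ?_⟩
    exact (Finset.mem_filter.1 h).2.1.not_ge hm.2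
  · obtain ⟨-, h1, h2⟩ := Finset.mem_filter.1 hm
    have h3 : 0 < y m := lt_of_le_of_ne (hy0 m) (Ne.symm h2)
    change _ ≤ powerSing β (y m)
    rw [powerSing_of_pos h3]
    exact Real.rpow_le_rpow_of_nonpos h3 h1.le (by linarith)
  · change powerSing β (y m) ≤ _
    rcases eq_or_ne (y m) 0 with h | h
    · rw [powerSing, if_pos h]
      exact hv
    · have h3 : 0 < y m := lt_of_le_of_ne (hy0 m) (Ne.symm h)
      rw [powerSing_of_pos h3]
      rw [Finset.mem_sdiff] at hm
      refine Real.rpow_le_rpow_of_nonpos ht (not_lt.1 fun h' => ?_) (by linarith)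
      exact hm.2 (Finset.mem_filter.2 ⟨hm.1, h', h⟩)

end Sandwich

/-! ## Power sums over equidistributed points -/

lemma intervalIntegrable_rpow_mul_linear {β τ : ℝ} (hτ : 0 < τ) (hτ1 : τ ≤ 1) (a b : ℝ) :
    IntervalIntegrable (fun t : ℝ => β * t ^ (-β - 1) * (a * t + b)) volume τ 1 := by
  apply ContinuousOn.intervalIntegrable
  rw [Set.uIcc_of_le hτ1]
  have : ContinuousOn (fun t : ℝ => t ^ (-β - 1)) (Set.Icc τ 1) :=
    ContinuousOn.rpow_const continuousOn_id fun t ht => Or.inl (hτ.trans_le ht.1).ne'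
  fun_prop

lemma integral_rpow_mul_linear {β τ : ℝ} (hβ : 1 < β) (hτ : 0 < τ) (hτ1 : τ ≤ 1) (a b : ℝ) :
    ∫ t in τ..1, β * t ^ (-β - 1) * (a * t + b) =
      a * (β * (τ ^ (1 - β) - 1) / (β - 1)) + b * (τ ^ (-β) - 1) := by
  have h0 : (0 : ℝ) ∉ Set.uIcc τ 1 := by
    rw [Set.uIcc_of_le hτ1]
    exact fun h => hτ.not_ge h.1
  have e : Set.EqOn (fun t : ℝ => β * t ^ (-β - 1) * (a * t + b))
      (fun t => a * β * t ^ (-β) + b * β * t ^ (-β - 1)) (Set.uIcc τ 1) := by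
    intro t ht
    rw [Set.uIcc_of_le hτ1] at ht
    have ht0 : 0 < t := hτ.trans_le ht.1
    have : t ^ (-β) = t ^ (-β - 1) * t := by
      rw [Real.rpow_sub_one ht0.ne']
      field_simp
    simp only [this]
    ring
  rw [intervalIntegral.integral_congr e, intervalIntegral.integral_add,
    intervalIntegral.integral_const_mul, intervalIntegral.integral_const_mul,
    integral_rpow (Or.inr ⟨by linarith, h0⟩), integral_rpow (Or.inr ⟨by linarith, h0⟩)]
  · rw [Real.one_rpow, Real.one_rpow, show -β + 1 = 1 - β by ring, show -β - 1 + 1 = -β by ring]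
    have h1 : β - 1 ≠ 0 := by linarith
    have h2 : 1 - β ≠ 0 := by linarith
    have h3 : β ≠ 0 := by linarith
    have h4 : -β ≠ 0 := by linarith
    rw [show (1 - τ ^ (1 - β)) / (1 - β) = (τ ^ (1 - β) - 1) / (β - 1) by
      rw [div_eq_div_iff h2 h1]; ring]
    rw [show (1 - τ ^ (-β)) / -β = (τ ^ (-β) - 1) / β by
      rw [div_eq_div_iff h4 h3]; ring]
    field_simp
  · exact (intervalIntegral.intervalIntegrable_rpow (Or.inr h0)).const_mul _
  · exact (intervalIntegral.intervalIntegrable_rpow (Or.inr h0)).const_mul _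

lemma intervalIntegrable_rpow_indicator {β τ : ℝ} (hτ : 0 < τ) (hτ1 : τ ≤ 1) (y : ℝ) :
    IntervalIntegrable (fun t : ℝ => β * t ^ (-β - 1) * (if y < t then 1 else 0)) volume τ 1 := by
  have h := intervalIntegrable_rpow_mul_linear (β := β) hτ hτ1 0 1
  rw [intervalIntegrable_iff] at h ⊢
  have h2 := h.indicator (measurableSet_Ioi (a := y))
  refine h2.congr_fun_ae (ae_of_all _ fun t => ?_)
  by_cases ht : y < t <;> simp [Set.indicator, ht]

/-- The layer cake formula for `y ^ (-β)`. -/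
lemma rpow_neg_eq_one_add_integral {β τ y : ℝ} (hβ : 1 < β) (hτ : 0 < τ) (hy : τ ≤ y)
    (hy1 : y ≤ 1) :
    y ^ (-β) = 1 + ∫ t in τ..1, β * t ^ (-β - 1) * (if y < t then 1 else 0) := by
  have h1 := integral_rpow_mul_linear hβ (hτ.trans_le hy) hy1 0 1
  have i1 := intervalIntegrable_rpow_indicator (β := β) hτ (hy.trans hy1) y
  have i2 : IntervalIntegrable (fun t : ℝ => β * t ^ (-β - 1) * (if y < t then 1 else 0))
      volume τ y := i1.mono_set (by
        rw [Set.uIcc_of_le hy, Set.uIcc_of_le (hy.trans hy1)]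
        exact Set.Icc_subset_Icc le_rfl hy1)
  have i3 : IntervalIntegrable (fun t : ℝ => β * t ^ (-β - 1) * (if y < t then 1 else 0))
      volume y 1 := i1.mono_set (by
        rw [Set.uIcc_of_le hy1, Set.uIcc_of_le (hy.trans hy1)]
        exact Set.Icc_subset_Icc hy le_rfl)
  rw [← intervalIntegral.integral_add_adjacent_intervals i2 i3]
  have e1 : ∫ t in τ..y, β * t ^ (-β - 1) * (if y < t then 1 else 0) = 0 := by
    rw [intervalIntegral.integral_congr (g := fun _ => (0 : ℝ))]
    · simp
    · intro t ht
      rw [Set.uIcc_of_le hy] at ht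
      simp [not_lt.2 ht.2]
  have e2 : ∫ t in y..1, β * t ^ (-β - 1) * (if y < t then 1 else 0) =
      ∫ t in y..1, β * t ^ (-β - 1) * (0 * t + 1) := by
    refine intervalIntegral.integral_congr_ae (ae_of_all _ fun t ht => ?_)
    rw [Set.uIoc_of_le hy1] at ht
    simp [ht.1]
  rw [e1, e2, h1]
  ring

/-- If `N` points of `[0, 1)` are equidistributed at the scale `τ`, the sum of `y ^ (-β)` over those
points with `τ ≤ y` is close to `N` times the integral. -/
lemma abs_sum_filter_rpow_sub_le {ι : Type*} (s : Finset ι) (y : ι → ℝ) {β τ ε K : ℝ}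
    (hβ : 1 < β) (hτ : 0 < τ) (hτ1 : τ ≤ 1) (hε : 0 ≤ ε)
    (hy1 : ∀ i ∈ s, y i < 1)
    (hc : ∀ t, τ ≤ t → t ≤ 1 →
      |((s.filter (fun i => y i < t)).card : ℝ) - s.card * t| ≤ ε * (s.card * t + K)) :
    |∑ i ∈ s.filter (fun i => τ ≤ y i), y i ^ (-β) -
        s.card * ((τ ^ (1 - β) - 1) / (β - 1))| ≤
      ε * (s.card * τ + K) +
        2 * ε * (s.card * (β * (τ ^ (1 - β) - 1) / (β - 1)) + K * (τ ^ (-β) - 1)) := by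
  set N : ℝ := (s.card : ℝ) with hN
  set c : ℝ → ℝ := fun t => ((s.filter (fun i => y i < t)).card : ℝ) with hcdef
  set s' := s.filter (fun i => τ ≤ y i) with hs'
  have hN0 : 0 ≤ N := Nat.cast_nonneg _
  have hcard : (s'.card : ℝ) = N - c τ := by
    have := Finset.card_filter_add_card_filter_not (s := s) (fun i => τ ≤ y i)
    simp only [not_le] at this
    have h2 : ((s'.card : ℝ)) + c τ = N := by
      simp only [hcdef, hN, hs']
      exact_mod_cast this
    linarith
  have hcount : ∀ t, τ ≤ t → ∑ i ∈ s', (if y i < t then (1 : ℝ) else 0) = c t - c τ := by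
    intro t ht
    have h1 : c t = ∑ i ∈ s, (if y i < t then (1 : ℝ) else 0) := by
      simp [hcdef]
    have h2 : c τ = ∑ i ∈ s, (if y i < τ then (1 : ℝ) else 0) := by
      simp [hcdef]
    rw [h1, h2, ← Finset.sum_sub_distrib, hs', Finset.sum_filter]
    refine Finset.sum_congr rfl fun i _ => ?_
    by_cases h3 : τ ≤ y i
    · simp [h3, not_lt.2 h3]
    · have h4 : y i < τ := not_le.1 h3
      simp [h3, h4, h4.trans_le ht]
  -- Layer cake for each point; the constant 1 in that formula counts the points with `τ ≤ y i`.
  have hsum : ∑ i ∈ s', y i ^ (-β) =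
      N - c τ + ∫ t in τ..1, ∑ i ∈ s', β * t ^ (-β - 1) * (if y i < t then 1 else 0) := by
    rw [intervalIntegral.integral_finsetSum
      fun i _ => intervalIntegrable_rpow_indicator hτ hτ1 (y i), ← hcard]
    rw [Finset.card_eq_sum_ones, Nat.cast_sum, ← Finset.sum_add_distrib]
    refine Finset.sum_congr rfl fun i hi => ?_
    obtain ⟨hi1, hi2⟩ := Finset.mem_filter.1 hi
    rw [rpow_neg_eq_one_add_integral hβ hτ hi2 (hy1 i hi1).le]
    simp
  have hint : IntervalIntegrable
      (fun t => ∑ i ∈ s', β * t ^ (-β - 1) * (if y i < t then 1 else 0)) volume τ 1 := by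
    rw [intervalIntegrable_iff]
    exact integrable_finsetSum s' fun i _ =>
      intervalIntegrable_iff.1 (intervalIntegrable_rpow_indicator hτ hτ1 (y i))
  -- `c t - c τ` is `N(t - τ)` up to the errors at `t` and at `τ`; the latter is no larger than the
  -- bound for the former, hence the factor `2ε`.
  have hpt : ∀ t ∈ Set.Icc τ 1,
      β * t ^ (-β - 1) * (N * (1 - 2 * ε) * t + (-2 * ε * K - N * τ)) ≤
        ∑ i ∈ s', β * t ^ (-β - 1) * (if y i < t then 1 else 0) ∧
      ∑ i ∈ s', β * t ^ (-β - 1) * (if y i < t then 1 else 0) ≤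
        β * t ^ (-β - 1) * (N * (1 + 2 * ε) * t + (2 * ε * K - N * τ)) := by
    intro t ht
    have ht0 : 0 < t := hτ.trans_le ht.1
    have hg : 0 ≤ β * t ^ (-β - 1) := by positivity
    rw [← Finset.mul_sum, hcount t ht.1]
    have h1 := abs_le.1 (hc t ht.1 ht.2)
    have h2 := abs_le.1 (hc τ le_rfl hτ1)
    have h3 : ε * (N * τ) ≤ ε * (N * t) := by gcongr; exact ht.1
    constructor
    · refine mul_le_mul_of_nonneg_left ?_ hg
      linarith [h1.1, h2.2]
    · refine mul_le_mul_of_nonneg_left ?_ hg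
      linarith [h1.2, h2.1]
  have hup := intervalIntegral.integral_mono_on hτ1 hint
    (intervalIntegrable_rpow_mul_linear hτ hτ1 _ _) (fun t ht => (hpt t ht).2)
  have hlo := intervalIntegral.integral_mono_on hτ1
    (intervalIntegrable_rpow_mul_linear hτ hτ1 _ _) hint (fun t ht => (hpt t ht).1)
  rw [integral_rpow_mul_linear hβ hτ hτ1] at hup hlo
  have hT : τ ^ (-β) * τ = τ ^ (1 - β) := by
    rw [show (1 - β) = -β + 1 by ring, Real.rpow_add_one hτ.ne']
  have h2 : |c τ - N * τ| ≤ ε * (N * τ + K) := hc τ le_rfl hτ1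
  rw [abs_le] at h2
  have hβ1 : β - 1 ≠ 0 := by linarith
  set T := τ ^ (1 - β) with hTdef
  -- With this splitting the main terms `N(1 - τ)`, `Nβ(T - 1)/(β - 1)` and `-Nτ(τ^{-β} - 1)` add up
  -- to `N(T - 1)/(β - 1)`.
  have hsplit : β * (T - 1) / (β - 1) = (T - 1) + (T - 1) / (β - 1) := by
    field_simp
    ring
  rw [hsplit] at hup hlo ⊢
  rw [hsum, abs_le]
  have hT' : N * τ * (τ ^ (-β)) = N * T := by rw [← hT]; ring
  constructor
  · linarith [h2.2]
  · linarith [h2.1]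

/-! ## The uniform law -/

/-- Restricting `σ` to `[1/2, 2]` makes the error constants independent of `σ`, through `σ^e ≤ 2^β`
for `-β ≤ e ≤ 0`. The term `N/(β - 1)` is the contribution of the upper endpoint 1 of the integral.
-/
lemma abs_sum_filter_rpow_sub_le_of_scale {ι : Type*} (s : Finset ι) (y : ι → ℝ)
    {β σ ε K κ : ℝ} (hβ : 1 < β) (hκ : 0 < κ) (hκ1 : κ ≤ 1) (hK : K = s.card * κ)
    (hσ : 1 / 2 ≤ σ) (hσ2 : σ ≤ 2) (hτ1 : σ * κ ≤ 1) (hε : 0 ≤ ε) (hy1 : ∀ i ∈ s, y i < 1)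
    (hc : ∀ t, 0 ≤ t → t ≤ 1 →
      |((s.filter (fun i => y i < t)).card : ℝ) - s.card * t| ≤ ε * (s.card * t + K)) :
    |∑ i ∈ s.filter (fun i => σ * κ ≤ y i), y i ^ (-β) -
        σ ^ (1 - β) * (s.card * κ ^ (1 - β) / (β - 1))| ≤
      s.card / (β - 1) +
        ε * (3 + 2 * (β * 2 ^ β / (β - 1) + 2 ^ β)) * (s.card * κ ^ (1 - β)) := by
  have hσ0 : 0 < σ := by linarith
  have hτ : 0 < σ * κ := by positivity
  have hβ1 : 0 < β - 1 := by linarith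
  have h := abs_sum_filter_rpow_sub_le s y hβ hτ hτ1 hε hy1
    (fun t ht ht1 => hc t (hτ.le.trans ht) ht1)
  have hhalf : ∀ e : ℝ, e ≤ 0 → -β ≤ e → σ ^ e ≤ 2 ^ β := by
    intro e he he'
    calc σ ^ e ≤ (1 / 2 : ℝ) ^ e := Real.rpow_le_rpow_of_nonpos (by norm_num) hσ he
      _ = 2 ^ (-e) := by rw [one_div, Real.inv_rpow (by norm_num), Real.rpow_neg (by norm_num)]
      _ ≤ 2 ^ β := Real.rpow_le_rpow_of_exponent_le (by norm_num) (by linarith)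
  have h1 := hhalf (1 - β) (by linarith) (by linarith)
  have h2 := hhalf (-β) (by linarith) le_rfl
  have hκβ : κ * κ ^ (-β) = κ ^ (1 - β) := by
    rw [show (1 - β) = -β + 1 by ring, Real.rpow_add_one hκ.ne', mul_comm]
  have hκQ : κ ≤ κ ^ (1 - β) := by
    conv_lhs => rw [← Real.rpow_one κ]
    exact Real.rpow_le_rpow_of_exponent_ge hκ hκ1 (by linarith)
  rw [Real.mul_rpow hσ0.le hκ.le, Real.mul_rpow hσ0.le hκ.le] at h
  set N : ℝ := (s.card : ℝ) with hN
  have hN0 : 0 ≤ N := Nat.cast_nonneg _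
  set Q := κ ^ (1 - β) with hQ
  have hQ0 : 0 < Q := by positivity
  have e1 : N * (σ * κ) + K ≤ 3 * (N * Q) := by
    rw [hK]
    have : N * κ ≤ N * Q := by gcongr
    have h5 : σ * (N * κ) ≤ 2 * (N * κ) := by gcongr
    linarith
  have e2 : N * (β * (σ ^ (1 - β) * Q - 1) / (β - 1)) ≤ β * 2 ^ β / (β - 1) * (N * Q) := by
    rw [div_mul_eq_mul_div, mul_div_assoc', div_le_div_iff_of_pos_right hβ1]
    have h5 : σ ^ (1 - β) * Q ≤ 2 ^ β * Q := by gcongr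
    calc N * (β * (σ ^ (1 - β) * Q - 1)) ≤ N * (β * (2 ^ β * Q)) := by
          gcongr
          linarith
      _ = β * 2 ^ β * (N * Q) := by ring
  have e3 : K * (σ ^ (-β) * κ ^ (-β) - 1) ≤ 2 ^ β * (N * Q) := by
    calc K * (σ ^ (-β) * κ ^ (-β) - 1) = N * (σ ^ (-β) * (κ * κ ^ (-β))) - N * κ := by
          rw [hK]; ring
      _ ≤ N * (2 ^ β * (κ * κ ^ (-β))) - 0 := by gcongr; positivity
      _ = 2 ^ β * (N * Q) := by rw [hκβ]; ring
  have e4 : ε * (N * (σ * κ) + K) ≤ ε * (3 * (N * Q)) := by gcongr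
  have e5 : 2 * ε * (N * (β * (σ ^ (1 - β) * Q - 1) / (β - 1)) + K * (σ ^ (-β) * κ ^ (-β) - 1)) ≤
      2 * ε * (β * 2 ^ β / (β - 1) * (N * Q) + 2 ^ β * (N * Q)) := by gcongr
  have e6 : N * ((σ ^ (1 - β) * Q - 1) / (β - 1)) =
      σ ^ (1 - β) * (N * Q / (β - 1)) - N / (β - 1) := by field_simp
  rw [e6] at h
  have h7 : 0 ≤ N / (β - 1) := by positivity
  rw [abs_le] at h ⊢
  constructor
  · linarith [h.1]
  · linarith [h.2]

lemma powerNorm_eq {β : ℝ} {k : ℕ → ℕ} {N : ℕ} (hN : 0 < N) :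
    powerNorm β k N = N * (k N / N : ℝ) ^ (1 - β) / (β - 1) := by
  have hN' : (0 : ℝ) < N := by exact_mod_cast hN
  rw [powerNorm, Real.div_rpow (Nat.cast_nonneg _) hN'.le,
    show β = 1 - (1 - β) by ring, Real.rpow_sub hN', Real.rpow_one]
  rw [show 1 - (1 - (1 - β)) = 1 - β by ring]
  ring

lemma OstrowskiGrowth.tendsto {α : ℝ} (hα : Irrational α) {k : ℕ → ℕ} (hg : OstrowskiGrowth α k) :
    Tendsto (fun N => (k N : ℝ)) atTop atTop := by
  refine tendsto_atTop_mono' _ ?_ hg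
  filter_upwards [eventually_ge_atTop 1] with N hN
  refine div_le_self (Nat.cast_nonneg _) ?_
  exact_mod_cast (one_le_ostrowskiDigit_index hα hN).trans (le_max_left _ _)

lemma exists_rpow_near_one (β : ℝ) {η : ℝ} (hη : 0 < η) : ∃ δ : ℝ, 0 < δ ∧ δ ≤ 1 / 2 ∧
    (1 - δ) ^ (1 - β) < 1 + η / 4 ∧ 1 - η / 4 < (1 + δ) ^ (1 - β) := by
  have hcont : ContinuousAt (fun σ : ℝ => σ ^ (1 - β)) 1 :=
    Real.continuousAt_rpow_const _ _ (Or.inl one_ne_zero)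
  rw [Metric.continuousAt_iff] at hcont
  obtain ⟨δ, hδ, h⟩ := hcont (η / 4) (by linarith)
  have hm : 0 < min (δ / 2) (1 / 2) := by positivity
  have hm1 : min (δ / 2) (1 / 2) ≤ δ / 2 := min_le_left _ _
  refine ⟨min (δ / 2) (1 / 2), hm, min_le_right _ _, ?_, ?_⟩
  · have := @h (1 - min (δ / 2) (1 / 2)) (by
      rw [Real.dist_eq, abs_lt]; constructor <;> linarith)
    rw [Real.dist_eq, Real.one_rpow, abs_lt] at this
    linarith
  · have := @h (1 + min (δ / 2) (1 / 2)) (by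
      rw [Real.dist_eq, abs_lt]; constructor <;> linarith)
    rw [Real.dist_eq, Real.one_rpow, abs_lt] at this
    linarith

/-- At `t = (1 ± δ)κ` the counting error is at most `ε(2 + δ)k ≤ δk/2`. So the count is at least `k
+ δk/2 ≥ k + 1` on the plus side and at most `k` on the minus side. -/
lemma trimmedSum_mem_Ioo_of_scale {α β δ ε η κ P x : ℝ} {N k : ℕ} (hα : Irrational α) (hβ : 0 ≤ β)
    (hx : x ∈ Set.Ico (0 : ℝ) 1) (hκpos : 0 < κ) (hκ : κ < 1 / 2) (hK : (k : ℝ) = N * κ)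
    (hkN : k ≤ N) (hδ0 : 0 < δ) (hδ1 : δ ≤ 1 / 2) (hk2 : 2 ≤ k * δ) (hε : 0 < ε) (hεδ : ε ≤ δ / 5)
    (hη : 0 < η) (hPpos : 0 < P) (hδm : (1 - δ) ^ (1 - β) < 1 + η / 4)
    (hδp : 1 - η / 4 < (1 + δ) ^ (1 - β))
    (hvis : ∀ t : ℝ, 0 ≤ t → |(visits α x t N : ℝ) - N * t| ≤ ε * (N * t + k))
    (hscale : ∀ σ : ℝ, 1 / 2 ≤ σ → σ ≤ 2 →
      |∑ m ∈ (Finset.range N).filter (fun m : ℕ => σ * κ ≤ Int.fract (x + m * α)),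
        powerSing β (Int.fract (x + m * α)) - σ ^ (1 - β) * P| < η / 2 * P) :
    trimmedSum (rotation α) (powerSing β) N k x ∈ Set.Ioo ((1 - η) * P) ((1 + η) * P) := by
  have hδκ : 0 < δ * κ := mul_pos hδ0 hκpos
  have hδκ' : δ * κ ≤ 1 / 2 * κ := by gcongr
  have hηP : 0 < η * P := mul_pos hη hPpos
  have hmP : (1 - δ) ^ (1 - β) * P ≤ (1 + η / 4) * P := by gcongr
  have hpP : (1 - η / 4) * P ≤ (1 + δ) ^ (1 - β) * P := by gcongr
  have hεk : ε * k ≤ δ / 5 * k := by gcongr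
  have hεδk : δ * (ε * k) ≤ 1 / 2 * (ε * k) := by gcongr
  have hεk0 : 0 ≤ ε * k := by positivity
  have hεδk0 : 0 ≤ δ * (ε * k) := by positivity
  constructor
  · have h1 := (abs_lt.1 (hscale (1 + δ) (by linarith) (by linarith))).1
    refine lt_of_lt_of_le ?_ (sum_filter_le_trimmedSum hα hβ hx hkN
      (t := (1 + δ) * κ) (by linarith) (by nlinarith) ?_)
    · linarith
    · have h2 := (abs_le.1 (hvis ((1 + δ) * κ) (by linarith))).1
      have e : (N : ℝ) * ((1 + δ) * κ) = (1 + δ) * k := by rw [hK]; ring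
      rw [e] at h2
      have h3 : (k + 1 : ℝ) ≤ visits α x ((1 + δ) * κ) N := by
        linarith
      exact_mod_cast h3
  · have h1 := (abs_lt.1 (hscale (1 - δ) (by linarith) (by linarith))).2
    refine (trimmedSum_le_sum_filter hx hkN (t := (1 - δ) * κ) (by linarith) (by linarith)
      ?_).trans_lt ?_
    · have h2 := (abs_le.1 (hvis ((1 - δ) * κ) (by linarith))).2
      have e : (N : ℝ) * ((1 - δ) * κ) = (1 - δ) * k := by rw [hK]; ring
      rw [e] at h2
      have h3 : (visits α x ((1 - δ) * κ) N : ℝ) ≤ k := by linarith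
      exact_mod_cast h3
    · linarith

theorem OstrowskiGrowth.uniformTrimmedStrongLaw {α β : ℝ} (hα : Irrational α)
    (hα01 : α ∈ Set.Ioo (0 : ℝ) 1) (hβ : 1 < β) {k : ℕ → ℕ}
    (hko : (fun N => (k N : ℝ)) =o[atTop] (fun N : ℕ => (N : ℝ)))
    (hg : OstrowskiGrowth α k) :
    UniformTrimmedStrongLaw α β k (powerNorm β k) := by
  rw [UniformTrimmedStrongLaw, Metric.tendstoUniformlyOn_iff]
  intro η hη
  have hβ1 : 0 < β - 1 := by linarith
  obtain ⟨δ, hδ0, hδ1, hδm, hδp⟩ := exists_rpow_near_one β hη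
  set C : ℝ := 3 + 2 * (β * 2 ^ β / (β - 1) + 2 ^ β) with hC
  have hC0 : 0 < C := by positivity
  set ε : ℝ := min (δ / 5) (η / (4 * C * (β - 1))) with hεdef
  have hε : 0 < ε := by positivity
  have hεδ : ε ≤ δ / 5 := min_le_left _ _
  have hεη : ε * C * (β - 1) ≤ η / 4 := by
    have : ε ≤ η / (4 * C * (β - 1)) := min_le_right _ _
    rw [le_div_iff₀ (by positivity)] at this
    linarith
  have hκ0 : Tendsto (fun N : ℕ => (k N : ℝ) / N) atTop (𝓝 0) := hko.tendsto_div_nhds_zero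
  have hκβ : Tendsto (fun N : ℕ => ((k N : ℝ) / N) ^ (β - 1)) atTop (𝓝 0) := by
    have := hκ0.rpow_const (p := β - 1) (Or.inr hβ1.le)
    rwa [Real.zero_rpow hβ1.ne'] at this
  filter_upwards [hg.eventually_abs_visits_sub_le hα hα01 hε, eventually_ge_atTop 1,
    (hg.tendsto hα).eventually_ge_atTop (max 1 (2 / δ)),
    hκ0.eventually_lt_const (show (0 : ℝ) < 1 / 2 by norm_num),
    hκβ.eventually_lt_const (show 0 < η / 4 by linarith)] with N hvis hN hk hκ hκη x hx
  have hN' : (0 : ℝ) < N := by exact_mod_cast hN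
  have hk1 : (1 : ℝ) ≤ k N := (le_max_left _ _).trans hk
  have hk2 : 2 ≤ k N * δ := by
    have := (le_max_right _ _).trans hk
    rwa [div_le_iff₀ hδ0] at this
  set κ : ℝ := (k N : ℝ) / N with hκdef
  have hκpos : 0 < κ := by positivity
  have hK : (k N : ℝ) = N * κ := by rw [hκdef]; field_simp
  have hkN : k N ≤ N := by
    have : (k N : ℝ) ≤ N := by rw [hK]; nlinarith
    exact_mod_cast this
  have hP : powerNorm β k N = N * κ ^ (1 - β) / (β - 1) := powerNorm_eq hN
  have hQ : 0 < κ ^ (1 - β) := by positivity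
  have hPpos : 0 < powerNorm β k N := by rw [hP]; positivity
  set P := powerNorm β k N with hPdef
  -- The first term is `κ^{β-1} P`, negligible because `k = o(N)`; the second is at most `(η/4) P`
  -- by the choice of `ε`.
  have hsmall : (N : ℝ) / (β - 1) + ε * C * (N * κ ^ (1 - β)) < η / 2 * P := by
    have h1 : (N : ℝ) / (β - 1) = κ ^ (β - 1) * P := by
      rw [hP, show (1 - β) = -(β - 1) by ring, Real.rpow_neg hκpos.le]
      have : κ ^ (β - 1) ≠ 0 := by positivity
      field_simp
    have h2 : ε * C * (N * κ ^ (1 - β)) = ε * C * (β - 1) * P := by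
      rw [hP]
      field_simp
    rw [h1, h2]
    nlinarith
  have hscale : ∀ σ : ℝ, 1 / 2 ≤ σ → σ ≤ 2 →
      |∑ m ∈ (Finset.range N).filter (fun m : ℕ => σ * κ ≤ Int.fract (x + m * α)),
        powerSing β (Int.fract (x + m * α)) - σ ^ (1 - β) * P| < η / 2 * P := by
    intro σ h1 h2
    have hσκ : 0 < σ * κ := by nlinarith
    have h3 := abs_sum_filter_rpow_sub_le_of_scale (Finset.range N)
      (fun m : ℕ => Int.fract (x + m * α)) (K := k N) hβ hκpos (by linarith)
      (by rw [Finset.card_range, hK]) h1 h2 (by nlinarith) hε.le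
      (fun m _ => Int.fract_lt_one _) (fun t ht ht1 => by
        have := hvis x t ht
        rw [visits_eq_card ht ht1] at this
        simpa using this)
    rw [Finset.card_range, ← hP] at h3
    refine lt_of_le_of_lt (le_of_eq ?_) (h3.trans_lt hsmall)
    congr 2
    refine Finset.sum_congr rfl fun m hm => ?_
    exact powerSing_of_pos (hσκ.trans_le (Finset.mem_filter.1 hm).2)
  obtain ⟨hlo, hup⟩ := trimmedSum_mem_Ioo_of_scale hα (by linarith) hx hκpos hκ hK hkN hδ0 hδ1 hk2
    hε hεδ hη hPpos hδm hδp (hvis x) hscale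
  rw [dist_comm, Real.dist_eq, abs_lt, lt_sub_iff_add_lt, sub_lt_iff_lt_add, lt_div_iff₀ hPpos,
    div_lt_iff₀ hPpos]
  constructor <;> linarith

/-! ## Failure of the weak law without the growth condition -/

section Comparison

variable {α β : ℝ} {n b C : ℕ} {x : ℝ}

/-- A bin of length `1/q` has expected count `b`, and each of its two endpoints contributes an error
`3b`. -/
lemma card_filter_floor_le (hα : Irrational α) (hα01 : α ∈ Set.Ioo (0 : ℝ) 1) (i : ℕ)
    (hi : i + 1 ≤ cfDenom α (n + 1)) :
    ((Finset.range (b * cfDenom α (n + 1))).filter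
      (fun m : ℕ => ⌊cfDenom α (n + 1) * Int.fract (x + m * α)⌋₊ = i)).card ≤ 7 * b := by
  set q := cfDenom α (n + 1) with hq
  have hq0 : (0 : ℝ) < q := by exact_mod_cast cfDenom_pos hα n
  have hi1 : (i + 1 : ℝ) ≤ q := by exact_mod_cast hi
  have h1 := abs_visits_mul_cfDenom_sub_le hα hα01 n b x (i / q)
  have h2 := abs_visits_mul_cfDenom_sub_le hα hα01 n b x ((i + 1) / q)
  rw [← hq, visits_eq_card (by positivity) (by rw [div_le_one hq0]; linarith)] at h1 h2
  set R := Finset.range (b * q)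
  have hsub : (R.filter (fun m : ℕ => ⌊q * Int.fract (x + m * α)⌋₊ = i)) ⊆
      (R.filter (fun m : ℕ => Int.fract (x + m * α) < (i + 1) / q)) \
      (R.filter (fun m : ℕ => Int.fract (x + m * α) < i / q)) := by
    intro m hm
    obtain ⟨hm1, hm2⟩ := Finset.mem_filter.1 hm
    rw [Nat.floor_eq_iff (by have := Int.fract_nonneg (x + m * α); positivity)] at hm2
    simp only [Finset.mem_sdiff, Finset.mem_filter, hm1, true_and, not_lt, lt_div_iff₀ hq0]
    constructor <;> linarith [hm2.1, hm2.2]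
  have hsub2 : (R.filter (fun m : ℕ => Int.fract (x + m * α) < i / q)) ⊆
      (R.filter (fun m : ℕ => Int.fract (x + m * α) < (i + 1) / q)) := by
    intro m
    simp only [Finset.mem_filter]
    refine fun h => ⟨h.1, h.2.trans_le ?_⟩
    gcongr
    linarith
  have h3 := Finset.card_le_card hsub
  have h4 := Finset.card_sdiff_add_card_eq_card hsub2
  have e1 : ((b * q : ℕ) : ℝ) * (i / q) = b * i := by push_cast; field_simp
  have e2 : ((b * q : ℕ) : ℝ) * ((i + 1) / q) = b * (i + 1) := by push_cast; field_simp
  rw [e1] at h1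
  rw [e2] at h2
  have h5 := (abs_le.1 h1).1
  have h6 := (abs_le.1 h2).2
  have h7 : (((R.filter (fun m : ℕ => ⌊q * Int.fract (x + m * α)⌋₊ = i)).card : ℕ) : ℝ) +
      (R.filter (fun m : ℕ => Int.fract (x + m * α) < i / q)).card ≤
      (R.filter (fun m : ℕ => Int.fract (x + m * α) < (i + 1) / q)).card := by
    have h : _ + _ ≤ _ := (Nat.add_le_add_right h3 _).trans h4.le
    exact_mod_cast h
  have h8 : (((R.filter (fun m : ℕ => ⌊q * Int.fract (x + m * α)⌋₊ = i)).card : ℕ) : ℝ) ≤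
      (7 * b : ℕ) := by
    push_cast at *
    linarith
  exact_mod_cast h8

/-- Bin `i ≥ 1` contributes at most `7b (q/i)^β`. Bin 0 is empty by the cutoff `1/q`; the series is
`ζ(β)`, its term at 0 being 0. -/
lemma sum_filter_rpow_le (hα : Irrational α) (hα01 : α ∈ Set.Ioo (0 : ℝ) 1) (hβ : 1 < β) :
    ∑ m ∈ (Finset.range (b * cfDenom α (n + 1))).filter
        (fun m : ℕ => 1 / (cfDenom α (n + 1) : ℝ) ≤ Int.fract (x + m * α)),
      Int.fract (x + m * α) ^ (-β) ≤
      7 * b * ((cfDenom α (n + 1) : ℝ) ^ β * ∑' i : ℕ, (i : ℝ) ^ (-β)) := by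
  set q := cfDenom α (n + 1) with hq
  have hq0 : (0 : ℝ) < q := by exact_mod_cast cfDenom_pos hα n
  set R := Finset.range (b * q) with hR
  set y : ℕ → ℝ := fun m => Int.fract (x + m * α) with hy
  set F := R.filter (fun m => 1 / (q : ℝ) ≤ y m) with hF
  have hmaps : ∀ m ∈ F, ⌊q * y m⌋₊ ∈ Finset.range q := by
    intro m hm
    rw [Finset.mem_range, Nat.floor_lt (mul_nonneg hq0.le (Int.fract_nonneg _))]
    have : y m < 1 := Int.fract_lt_one _
    nlinarith
  have hfib : ∀ i ∈ Finset.range q, ∑ m ∈ F.filter (fun m => ⌊q * y m⌋₊ = i), y m ^ (-β) ≤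
      7 * b * ((q : ℝ) ^ β * (i : ℝ) ^ (-β)) := by
    intro i hi
    rcases Nat.eq_zero_or_pos i with rfl | hi0
    · rw [Finset.sum_eq_zero]
      · positivity
      · intro m hm
        obtain ⟨h1, h2⟩ := Finset.mem_filter.1 hm
        have h3 := (Finset.mem_filter.1 h1).2
        rw [Nat.floor_eq_zero] at h2
        rw [div_le_iff₀ hq0] at h3
        linarith
    · have hi0' : (0 : ℝ) < i := by exact_mod_cast hi0
      have hcard : ((F.filter (fun m => ⌊q * y m⌋₊ = i)).card : ℝ) ≤ 7 * b := by
        have h1 := card_filter_floor_le (n := n) (b := b) (x := x) hα hα01 i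
          (Finset.mem_range.1 hi)
        have h2 : (F.filter (fun m => ⌊q * y m⌋₊ = i)).card ≤ 7 * b :=
          (Finset.card_le_card (Finset.filter_subset_filter _ (Finset.filter_subset _ _))).trans h1
        exact_mod_cast h2
      have hterm : ∀ m ∈ F.filter (fun m => ⌊q * y m⌋₊ = i),
          y m ^ (-β) ≤ (q : ℝ) ^ β * (i : ℝ) ^ (-β) := by
        intro m hm
        have h2 := (Finset.mem_filter.1 hm).2
        rw [Nat.floor_eq_iff (mul_nonneg hq0.le (Int.fract_nonneg _))] at h2
        have h3 : (i : ℝ) / q ≤ y m := by rw [div_le_iff₀ hq0]; linarith [h2.1]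
        calc y m ^ (-β) ≤ ((i : ℝ) / q) ^ (-β) :=
              Real.rpow_le_rpow_of_nonpos (by positivity) h3 (by linarith)
          _ = (q : ℝ) ^ β * (i : ℝ) ^ (-β) := by
              rw [Real.div_rpow hi0'.le hq0.le, Real.rpow_neg hq0.le, div_inv_eq_mul, mul_comm]
      refine (Finset.sum_le_card_nsmul _ _ _ hterm).trans ?_
      rw [nsmul_eq_mul]
      gcongr
  rw [← Finset.sum_fiberwise_of_maps_to hmaps]
  refine (Finset.sum_le_sum hfib).trans ?_
  rw [← Finset.mul_sum, ← Finset.mul_sum]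
  gcongr
  exact (Real.summable_nat_rpow.2 (by linarith)).sum_le_tsum _ fun i _ => by positivity

/-- The factor by which the trimmed sum drops when no orbit point crosses the singularity. -/
def dropFactor (β : ℝ) (C : ℕ) : ℝ :=
  1 - (1 - (1 + 1 / (4 * (C + 4) : ℝ)) ^ (-β)) /
    (1 + 7 * (∑' i : ℕ, (i : ℝ) ^ (-β)) * ((C + 4 : ℝ) ^ β))

lemma dropFactor_mem (hβ : 1 < β) (C : ℕ) : dropFactor β C ∈ Set.Ico (0 : ℝ) 1 := by
  have hZ : (0 : ℝ) ≤ ∑' i : ℕ, (i : ℝ) ^ (-β) := tsum_nonneg fun i => by positivity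
  have h1 : (1 + 1 / (4 * (C + 4) : ℝ)) ^ (-β) < 1 :=
    Real.rpow_lt_one_of_one_lt_of_neg (by
      have : (0 : ℝ) < 1 / (4 * (C + 4) : ℝ) := by positivity
      linarith) (by linarith)
  have h2 : 0 ≤ (1 + 1 / (4 * (C + 4) : ℝ)) ^ (-β) := by positivity
  have h3 : 0 ≤ 7 * (∑' i : ℕ, (i : ℝ) ^ (-β)) * ((C + 4 : ℝ) ^ β) := by positivity
  unfold dropFactor
  constructor
  · rw [sub_nonneg, div_le_one (by linarith)]
    linarith
  · have : 0 < (1 - (1 + 1 / (4 * (C + 4) : ℝ)) ^ (-β)) /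
        (1 + 7 * (∑' i : ℕ, (i : ℝ) ^ (-β)) * ((C + 4 : ℝ) ^ β)) :=
      div_pos (by linarith) (by linarith)
    linarith

/-- The optimal trimming set for `x` is also a competitor for `x'`. With `L = C + 4`, an untrimmed
`y < L/q` grows at least by the factor `1 + 1/(4L)`, while the terms with `y ≥ L/q` do not increase
and total at most `7ζ(β)L^β` times the near ones. -/
lemma trimmedSum_le_dropFactor_mul (hα : Irrational α) (hα01 : α ∈ Set.Ioo (0 : ℝ) 1) (hβ : 1 < β)
    {k : ℕ} (hk : k ≤ C * b) (hC : C + 4 ≤ cfDenom α (n + 1)) {x' : ℝ}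
    (hx : x ∈ Set.Ico (0 : ℝ) 1) (hx' : x' ∈ Set.Ico (0 : ℝ) 1)
    (hpos : ∀ m < b * cfDenom α (n + 1), 0 < Int.fract (x + m * α))
    (hshift : ∀ m < b * cfDenom α (n + 1), Int.fract (x' + m * α) =
      Int.fract (x + m * α) + 1 / (4 * cfDenom α (n + 1))) :
    trimmedSum (rotation α) (powerSing β) (b * cfDenom α (n + 1)) k x' ≤
      dropFactor β C *
        trimmedSum (rotation α) (powerSing β) (b * cfDenom α (n + 1)) k x := by
  set q := cfDenom α (n + 1) with hq
  have hq0 : (0 : ℝ) < q := by exact_mod_cast cfDenom_pos hα n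
  have hkN : k ≤ b * q := hk.trans (by nlinarith)
  set R := Finset.range (b * q) with hR
  set y : ℕ → ℝ := fun m => Int.fract (x + m * α) with hy
  set L : ℝ := C + 4 with hL
  have hL0 : 0 < L := by positivity
  have hLq : L ≤ q := by rw [hL]; exact_mod_cast hC
  obtain ⟨s, hs1, hs2, hs3⟩ := exists_trimmedSum_eq (T := rotation α) (f := powerSing β)
    (x := x) hkN
  have hsum : ∑ m ∈ R \ s, powerSing β ((rotation α)^[m] x) = ∑ m ∈ R \ s, y m ^ (-β) := by
    refine Finset.sum_congr rfl fun m hm => ?_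
    have hmN := Finset.mem_range.1 (Finset.mem_sdiff.1 hm).1
    rw [rotation_iterate α hx, powerSing_of_pos (hpos m hmN)]
  have hsum' : ∑ m ∈ R \ s, powerSing β ((rotation α)^[m] x') =
      ∑ m ∈ R \ s, (y m + 1 / (4 * q)) ^ (-β) := by
    refine Finset.sum_congr rfl fun m hm => ?_
    have hmN := Finset.mem_range.1 (Finset.mem_sdiff.1 hm).1
    have := hpos m hmN
    rw [rotation_iterate α hx', hshift m hmN, powerSing_of_pos (by positivity)]
  refine (trimmedSum_le_sum_sdiff hs1 hs2).trans ?_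
  rw [hs3, hsum, hsum']
  have hyp : ∀ m ∈ R \ s, 0 < y m := fun m hm =>
    hpos m (Finset.mem_range.1 (Finset.mem_sdiff.1 hm).1)
  rw [← Finset.sum_filter_add_sum_filter_not (R \ s) (fun m => y m < L / q),
    ← Finset.sum_filter_add_sum_filter_not (R \ s) (fun m => y m < L / q)]
  set A := (R \ s).filter (fun m => y m < L / q) with hA
  set B := (R \ s).filter (fun m => ¬ y m < L / q) with hB
  set ρ : ℝ := (1 + 1 / (4 * L)) ^ (-β) with hρ
  set Z : ℝ := ∑' i : ℕ, (i : ℝ) ^ (-β) with hZ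
  have hZ0 : 0 ≤ Z := tsum_nonneg fun i => by positivity
  have hlow : b * ((q : ℝ) ^ β * L ^ (-β)) ≤ ∑ m ∈ A, y m ^ (-β) := by
    -- At least `bL - 3b = (C + 1)b` points lie below `L/q`, and at most `Cb` of them are trimmed.
    have hcard : (b : ℝ) ≤ A.card := by
      have h1 := (abs_le.1 (abs_visits_mul_cfDenom_sub_le hα hα01 n b x (L / q))).1
      rw [← hq, visits_eq_card (by positivity) (by rw [div_le_one hq0]; exact hLq)] at h1
      have e1 : ((b * q : ℕ) : ℝ) * (L / q) = b * L := by push_cast; field_simp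
      have h2 : R.filter (fun m => y m < L / q) ⊆ A ∪ s := by
        intro m
        simp only [hA, Finset.mem_filter, Finset.mem_union, Finset.mem_sdiff]
        tauto
      have h3 := (Finset.card_le_card h2).trans (Finset.card_union_le _ _)
      rw [hs2] at h3
      have h4 : ((R.filter (fun m => y m < L / q)).card : ℝ) ≤ A.card + (C * b : ℕ) := by
        exact_mod_cast h3.trans (by omega)
      rw [e1] at h1
      push_cast at h1 h4
      have h5 : (b : ℝ) * L - 3 * b ≤ A.card + C * b := by linarith
      rw [hL] at h5
      linarith
    have hterm : ∀ m ∈ A, (q : ℝ) ^ β * L ^ (-β) ≤ y m ^ (-β) := by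
      intro m hm
      obtain ⟨h1, h2⟩ := Finset.mem_filter.1 hm
      calc (q : ℝ) ^ β * L ^ (-β) = (L / q) ^ (-β) := by
            rw [Real.div_rpow hL0.le hq0.le, Real.rpow_neg hq0.le, div_inv_eq_mul, mul_comm]
        _ ≤ y m ^ (-β) := Real.rpow_le_rpow_of_nonpos (hyp m h1) h2.le (by linarith)
    calc b * ((q : ℝ) ^ β * L ^ (-β)) ≤ A.card * ((q : ℝ) ^ β * L ^ (-β)) := by gcongr
      _ = A.card • ((q : ℝ) ^ β * L ^ (-β)) := by rw [nsmul_eq_mul]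
      _ ≤ _ := Finset.card_nsmul_le_sum _ _ _ hterm
  have htail : ∑ m ∈ B, y m ^ (-β) ≤ 7 * b * ((q : ℝ) ^ β * Z) := by
    refine le_trans (Finset.sum_le_sum_of_subset_of_nonneg ?_ ?_)
      (sum_filter_rpow_le (n := n) (b := b) (x := x) hα hα01 hβ)
    · intro m hm
      obtain ⟨h1, h2⟩ := Finset.mem_filter.1 hm
      refine Finset.mem_filter.2 ⟨(Finset.mem_sdiff.1 h1).1, le_trans ?_ (not_lt.1 h2)⟩
      gcongr
      rw [hL]
      linarith [(Nat.cast_nonneg C : (0 : ℝ) ≤ C)]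
    · exact fun m _ _ => Real.rpow_nonneg (Int.fract_nonneg _) _
  have hA' : ∑ m ∈ A, (y m + 1 / (4 * q)) ^ (-β) ≤ ρ * ∑ m ∈ A, y m ^ (-β) := by
    rw [Finset.mul_sum]
    refine Finset.sum_le_sum fun m hm => ?_
    obtain ⟨h1, h2⟩ := Finset.mem_filter.1 hm
    have h3 := hyp m h1
    rw [hρ, ← Real.mul_rpow (by positivity) h3.le]
    refine Real.rpow_le_rpow_of_nonpos (by positivity) ?_ (by linarith)
    have h4 : 1 / (4 * L) * y m ≤ 1 / (4 * L) * (L / q) := by gcongr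
    have h5 : 1 / (4 * L) * (L / q) = 1 / (4 * q) := by field_simp
    linarith
  have hB' : ∑ m ∈ B, (y m + 1 / (4 * q)) ^ (-β) ≤ ∑ m ∈ B, y m ^ (-β) := by
    refine Finset.sum_le_sum fun m hm => ?_
    have h3 := hyp m (Finset.mem_filter.1 hm).1
    refine Real.rpow_le_rpow_of_nonpos h3 ?_ (by linarith)
    have : (0 : ℝ) < 1 / (4 * q) := by positivity
    linarith
  have hM : ∑ m ∈ B, y m ^ (-β) ≤ (7 * Z * L ^ β) * ∑ m ∈ A, y m ^ (-β) := by
    have e : 7 * b * ((q : ℝ) ^ β * Z) = (7 * Z * L ^ β) * (b * ((q : ℝ) ^ β * L ^ (-β))) := by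
      have : L ^ β * L ^ (-β) = 1 := by
        rw [← Real.rpow_add hL0, add_neg_cancel, Real.rpow_zero]
      linear_combination (-7 * b * Z * (q : ℝ) ^ β) * this
    rw [e] at htail
    exact htail.trans (by gcongr)
  have hρ1 : ρ < 1 := Real.rpow_lt_one_of_one_lt_of_neg (by
      have : (0 : ℝ) < 1 / (4 * L) := by positivity
      linarith) (by linarith)
  have hM0 : 0 < 1 + 7 * Z * L ^ β := by positivity
  have hdrop : dropFactor β C = 1 - (1 - ρ) / (1 + 7 * Z * L ^ β) := rfl
  rw [hdrop]
  set a := ∑ m ∈ A, y m ^ (-β)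
  set t := ∑ m ∈ B, y m ^ (-β)
  have h1 : (1 - ρ) / (1 + 7 * Z * L ^ β) * (a + t) ≤ (1 - ρ) * a := by
    rw [div_mul_eq_mul_div, div_le_iff₀ hM0, mul_assoc]
    refine mul_le_mul_of_nonneg_left ?_ (by linarith)
    linarith
  linarith

end Comparison

/-- Rotations do not increase the measure of preimages. -/
lemma volume_fract_add_mem_le (a : ℝ) (B : Set ℝ) :
    volume {x : ℝ | x ∈ Set.Ico (0 : ℝ) 1 ∧ Int.fract (x + a) ∈ B} ≤ volume B := by
  have hsub : {x : ℝ | x ∈ Set.Ico (0 : ℝ) 1 ∧ Int.fract (x + a) ∈ B} ⊆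
      (fun x => x + Int.fract a) ⁻¹' (B ∩ Set.Ici (Int.fract a)) ∪
      (fun x => x + (Int.fract a - 1)) ⁻¹' (B \ Set.Ici (Int.fract a)) := by
    rintro x ⟨⟨h0, h1⟩, hx⟩
    have ha0 := Int.fract_nonneg a
    have ha1 := Int.fract_lt_one a
    have e : Int.fract (x + a) = Int.fract (x + Int.fract a) := by
      rw [Int.fract_eq_fract]
      exact ⟨⌊a⌋, by rw [Int.fract]; ring⟩
    rw [e] at hx
    rcases lt_or_ge (x + Int.fract a) 1 with h | h
    · left
      rw [Int.fract_eq_self.2 ⟨by linarith, h⟩] at hx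
      exact ⟨hx, by simpa using h0⟩
    · right
      have e2 : Int.fract (x + Int.fract a) = x + (Int.fract a - 1) := by
        rw [Int.fract_eq_iff]
        exact ⟨by linarith, by linarith, 1, by push_cast; ring⟩
      rw [e2] at hx
      refine ⟨hx, fun h' => ?_⟩
      have := Set.mem_Ici.1 h'
      linarith
  refine (measure_mono hsub).trans ((measure_union_le _ _).trans ?_)
  rw [measure_preimage_add_right, measure_preimage_add_right]
  exact (measure_inter_add_sdiff B measurableSet_Ici).le

/-- For most `x`, no point of the orbit of length `b q_n` lies in a given short arc ending at the
singularity. -/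
lemma volume_exists_fract_notMem_le {α : ℝ} (hα : Irrational α) (hα01 : α ∈ Set.Ioo (0 : ℝ) 1)
    {n b : ℕ} (hb : 4 * (b - 1) ≤ cfCoeff α (n + 1)) :
    volume {x : ℝ | x ∈ Set.Ico (0 : ℝ) 1 ∧ ∃ m < b * cfDenom α (n + 1),
      Int.fract (x + m * α) ∉ Set.Ioo (0 : ℝ) (1 - 1 / (4 * cfDenom α (n + 1)))} ≤
    ENNReal.ofReal (3 / 4) := by
  set q := cfDenom α (n + 1) with hq
  have hqpos : 0 < q := cfDenom_pos hα n
  have hq0 : (0 : ℝ) < q := by exact_mod_cast hqpos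
  set Q := cfDenom α (n + 2) with hQ
  have hQ0 : (0 : ℝ) < Q := by exact_mod_cast cfDenom_pos hα (n + 1)
  set h : ℝ := 1 / (4 * q) with hh
  set D : ℝ := (b - 1 : ℕ) / Q with hD
  have hD0 : 0 ≤ D := by positivity
  have hh0 : 0 < h := by positivity
  have hqD : q * D ≤ 1 / 4 := by
    have h1 : cfCoeff α (n + 1) * q ≤ Q := cfCoeff_mul_cfDenom_le α (by omega)
    have h2 : 4 * (b - 1) * q ≤ Q := (Nat.mul_le_mul_right q hb).trans h1
    have h3 : 4 * ((b - 1 : ℕ) : ℝ) * q ≤ Q := by exact_mod_cast h2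
    rw [hD, mul_div_assoc', div_le_iff₀ hQ0]
    linarith
  have hqh : q * h = 1 / 4 := by rw [hh]; field_simp
  -- Writing `m = u q + v`, the point of index `m` differs from that of index `v` by a drift of at
  -- most `D`. So it suffices that the `q` points with `v < q` avoid `B`, which is the forbidden arc
  -- enlarged by `D` on both sides; since `qD ≤ 1/4`, the exceptional measure is at most `q(2D + h)
  -- ≤ 3/4`.
  set B : Set ℝ := (Set.Icc 0 D ∪ Set.Ico (1 - h - D) 1) ∩ Set.Ico 0 1 with hB
  have hvolB : volume B ≤ ENNReal.ofReal (2 * D + h) := by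
    refine (measure_mono Set.inter_subset_left).trans ((measure_union_le _ _).trans ?_)
    rw [Real.volume_Icc, Real.volume_Ico, ← ENNReal.ofReal_add (by linarith) (by linarith)]
    exact ENNReal.ofReal_le_ofReal (by linarith)
  have hsub : {x : ℝ | x ∈ Set.Ico (0 : ℝ) 1 ∧ ∃ m < b * q,
      Int.fract (x + m * α) ∉ Set.Ioo (0 : ℝ) (1 - h)} ⊆
      ⋃ v ∈ Finset.range q, {x : ℝ | x ∈ Set.Ico (0 : ℝ) 1 ∧ Int.fract (x + v * α) ∈ B} := by
    rintro x ⟨hx, m, hm, hfr⟩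
    simp only [Set.mem_iUnion, Finset.mem_range]
    refine ⟨m % q, Nat.mod_lt _ hqpos, hx, ?_⟩
    by_contra hnot
    refine hfr ?_
    set v := m % q with hv
    set u := m / q with hu
    have hub : u ≤ b - 1 := by
      have : u < b := (Nat.div_lt_iff_lt_mul hqpos).2 hm
      omega
    have hm' : (m : ℝ) = u * q + v := by exact_mod_cast (Nat.div_add_mod' m q).symm
    set z := Int.fract (x + v * α) with hz
    have hz0 : 0 ≤ z := Int.fract_nonneg _
    have hz1 : z < 1 := Int.fract_lt_one _
    have hz2 : D < z ∧ z < 1 - h - D := by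
      simp only [hB, Set.mem_inter_iff, Set.mem_union, Set.mem_Icc, Set.mem_Ico] at hnot
      constructor
      · by_contra hc
        exact hnot ⟨Or.inl ⟨hz0, not_lt.1 hc⟩, hz0, hz1⟩
      · by_contra hc
        exact hnot ⟨Or.inr ⟨not_lt.1 hc, hz1⟩, hz0, hz1⟩
    set δ : ℝ := q * α - cfNum α (n + 1) with hδ
    have hδQ : |δ| ≤ 1 / Q := abs_cfDenom_mul_sub_cfNum_le hα hα01 n
    have huδ : |u * δ| ≤ D := by
      rw [abs_mul, abs_of_nonneg (Nat.cast_nonneg u), hD, div_eq_mul_one_div]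
      have : (u : ℝ) ≤ (b - 1 : ℕ) := by exact_mod_cast hub
      gcongr
    rw [abs_le] at huδ
    have e : Int.fract (x + m * α) = z + u * δ := by
      rw [Int.fract_eq_iff]
      refine ⟨by linarith, by linarith, ⌊x + v * α⌋ + u * cfNum α (n + 1), ?_⟩
      rw [hm', hz, Int.fract, hδ]
      push_cast
      ring
    rw [e]
    constructor <;> linarith
  refine (measure_mono hsub).trans ((measure_biUnion_finset_le _ _).trans ?_)
  calc ∑ v ∈ Finset.range q, volume {x : ℝ | x ∈ Set.Ico (0 : ℝ) 1 ∧ Int.fract (x + v * α) ∈ B}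
      ≤ ∑ v ∈ Finset.range q, ENNReal.ofReal (2 * D + h) :=
        Finset.sum_le_sum fun v _ =>
          (volume_fract_add_mem_le _ _).trans hvolB
    _ = ENNReal.ofReal (q * (2 * D + h)) := by
        rw [Finset.sum_const, Finset.card_range, nsmul_eq_mul, ENNReal.ofReal_mul hq0.le,
          ENNReal.ofReal_natCast]
    _ ≤ ENNReal.ofReal (3 / 4) := ENNReal.ofReal_le_ofReal (by linarith)

/-- If the growth condition fails, trimming is too weak at infinitely many times `b q_n`. -/
lemma exists_trimming_le_of_not_ostrowskiGrowth {α : ℝ} (hα : Irrational α) {k : ℕ → ℕ}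
    (hk : Monotone k ∨ Antitone k) (hg : ¬ OstrowskiGrowth α k) :
    ∃ C : ℕ, ∀ n₀, ∃ n ≥ n₀, ∃ b, 1 ≤ b ∧ 4 * (b - 1) ≤ cfCoeff α (n + 1) ∧
      k (b * cfDenom α (n + 1)) ≤ C * b := by
  by_cases hbdd : ∃ C, ∀ N, k N ≤ C
  · obtain ⟨C, hC⟩ := hbdd
    exact ⟨C, fun n₀ => ⟨n₀, le_rfl, 1, le_rfl, by simp, by simpa using hC _⟩⟩
  have hmono : Monotone k := by
    refine hk.resolve_right fun h => hbdd ⟨k 0, fun N => h (Nat.zero_le N)⟩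
  push Not at hbdd
  have hg' : ∃ C : ℕ, ∃ᶠ N in atTop, k N ≤ C *
      max (ostrowskiDigit α N (ostrowskiIndex α N))
        ((Finset.Ico 1 (ostrowskiIndex α N)).sup (cfCoeff α)) := by
    by_contra hcon
    push Not at hcon
    refine hg (tendsto_atTop.2 fun c => ?_)
    filter_upwards [hcon ⌈c⌉₊, eventually_ge_atTop 1] with N hN hN1
    have h1 := (one_le_ostrowskiDigit_index hα hN1).trans
      (le_max_left _ ((Finset.Ico 1 (ostrowskiIndex α N)).sup (cfCoeff α)))
    rw [le_div_iff₀ (by exact_mod_cast h1)]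
    refine (mul_le_mul_of_nonneg_right (Nat.le_ceil c) (Nat.cast_nonneg _)).trans ?_
    exact_mod_cast hN.le
  obtain ⟨C, hC⟩ := hg'
  refine ⟨4 * C, fun n₀ => ?_⟩
  -- Beyond `N₁` the trimming exceeds `C a_j` for every `j ≤ n₀`, so the coefficient attaining the
  -- maximum must have index above `n₀`.
  obtain ⟨N₁, hN₁⟩ := hbdd (C * (Finset.Ico 1 (n₀ + 1)).sup (cfCoeff α))
  obtain ⟨N, hN, hidx, hN1, hNN⟩ := (hC.and_eventually
    (((tendsto_ostrowskiIndex α).eventually_ge_atTop (n₀ + 1)).and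
      ((eventually_ge_atTop 1).and (eventually_ge_atTop N₁)))).exists
  obtain ⟨-, hlow, -⟩ := ostrowskiIndex_spec hα hN1
  have hdig := ostrowskiDigit_index_le hα hN1
  have hdig1 := one_le_ostrowskiDigit_index hα hN1
  have hdigq : ostrowskiDigit α N (ostrowskiIndex α N) * cfDenom α (ostrowskiIndex α N) ≤ N := by
    rw [ostrowskiDigit_index]
    exact Nat.div_mul_le_self _ _
  set n := ostrowskiIndex α N
  have key : ∀ j c, n₀ + 1 ≤ j → 1 ≤ c → c ≤ cfCoeff α j → c * cfDenom α j ≤ N → k N ≤ C * c →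
      ∃ n ≥ n₀, ∃ b, 1 ≤ b ∧ 4 * (b - 1) ≤ cfCoeff α (n + 1) ∧
      k (b * cfDenom α (n + 1)) ≤ 4 * C * b := by
    intro j c hj hc1 hc hcN hkc
    -- The choice `b = ⌈c/4⌉` gives `4(b - 1) ≤ a_j` and costs a factor 4 in the constant; `k(b q_j)
    -- ≤ k(N)` by monotonicity.
    refine ⟨j - 1, by omega, (c + 3) / 4, by omega, ?_, ?_⟩
    · rw [show j - 1 + 1 = j by omega]
      omega
    · rw [show j - 1 + 1 = j by omega]
      have h1 : (c + 3) / 4 ≤ c := by omega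
      have h2 : c ≤ 4 * ((c + 3) / 4) := by omega
      calc k ((c + 3) / 4 * cfDenom α j) ≤ k N :=
            hmono ((Nat.mul_le_mul_right _ h1).trans hcN)
        _ ≤ C * c := hkc
        _ ≤ C * (4 * ((c + 3) / 4)) := Nat.mul_le_mul_left _ h2
        _ = 4 * C * ((c + 3) / 4) := by ring
  rcases max_choice (ostrowskiDigit α N n) ((Finset.Ico 1 n).sup (cfCoeff α)) with hmax | hmax
  · rw [hmax] at hN
    exact key n _ hidx hdig1 hdig hdigq hN
  · rw [hmax] at hN
    obtain ⟨j, hj, hjsup⟩ := Finset.exists_mem_eq_sup (Finset.Ico 1 n)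
      (by
        by_contra hempty
        rw [Finset.not_nonempty_iff_eq_empty] at hempty
        rw [hempty, Finset.sup_empty] at hmax
        simp at hmax
        omega) (cfCoeff α)
    rw [hjsup] at hN
    obtain ⟨hj1, hjn⟩ := Finset.mem_Ico.1 hj
    refine key j _ ?_ (one_le_cfCoeff hα hj1) le_rfl ?_ hN
    · by_contra hlt
      have h1 : cfCoeff α j ≤ (Finset.Ico 1 (n₀ + 1)).sup (cfCoeff α) :=
        Finset.le_sup (Finset.mem_Ico.2 ⟨hj1, by omega⟩)
      have h2 := Nat.mul_le_mul_left C h1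
      have h3 := hmono hNN
      omega
    · exact (cfCoeff_mul_cfDenom_le α hj1).trans ((cfDenom_mono hα hjn).trans hlow)

theorem TrimmedWeakLaw.ostrowskiGrowth {α β : ℝ} (hα : Irrational α)
    (hα01 : α ∈ Set.Ioo (0 : ℝ) 1) (hβ : 1 < β) {k : ℕ → ℕ} (hk : Monotone k ∨ Antitone k)
    {d : ℕ → ℝ} (hd : ∀ N, 1 ≤ N → 0 < d N) (hw : TrimmedWeakLaw α β k d) :
    OstrowskiGrowth α k := by
  by_contra hg
  obtain ⟨C, hC⟩ := exists_trimming_le_of_not_ostrowskiGrowth hα hk hg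
  obtain ⟨hρ0, hρ1⟩ := dropFactor_mem hβ C
  set ρ := dropFactor β C with hρ
  -- Good values at both `x` and `x'` would give `1 - ε ≤ ρ(1 + ε) ≤ ρ + ε`, that is `1 - ρ ≤ 2ε`.
  set ε : ℝ := (1 - ρ) / 4 with hε
  have hε0 : 0 < ε := by rw [hε]; linarith
  have hev := (hw ε hε0).eventually_lt_const
    (show (0 : ENNReal) < ENNReal.ofReal (1 / 8) by rw [ENNReal.ofReal_pos]; norm_num)
  obtain ⟨N₀, hN₀⟩ := eventually_atTop.1 hev
  obtain ⟨n, hn, b, hb1, hb, hkb⟩ := hC (N₀ + C + 4)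
  have hqn : n ≤ cfDenom α (n + 1) := le_cfDenom hα n
  have hqpos : 0 < cfDenom α (n + 1) := cfDenom_pos hα n
  have hNq : cfDenom α (n + 1) ≤ b * cfDenom α (n + 1) := Nat.le_mul_of_pos_left _ hb1
  have hbad := hN₀ (b * cfDenom α (n + 1)) (by omega)
  have hE := volume_exists_fract_notMem_le hα hα01 hb
  have hdN := hd (b * cfDenom α (n + 1)) (by omega)
  set q := cfDenom α (n + 1) with hq
  set N := b * q with hN
  have hq0 : (0 : ℝ) < q := by exact_mod_cast hqpos
  set bad : Set ℝ := {x : ℝ | x ∈ Set.Ico (0 : ℝ) 1 ∧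
      ε < |trimmedSum (rotation α) (powerSing β) N (k N) x / d N - 1|} with hbaddef
  set E' : Set ℝ := {x : ℝ | x ∈ Set.Ico (0 : ℝ) 1 ∧ ∃ m < N,
      Int.fract (x + m * α) ∉ Set.Ioo (0 : ℝ) (1 - 1 / (4 * q))} with hE'
  set bad' : Set ℝ := {x : ℝ | x ∈ Set.Ico (0 : ℝ) 1 ∧ Int.fract (x + 1 / (4 * q)) ∈ bad}
    with hbad'
  have hbad'vol : volume bad' ≤ volume bad := volume_fract_add_mem_le _ _
  -- The three excluded sets have measures below 1/8, below 1/8 and at most 3/4, hence total measure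
  -- below 1.
  obtain ⟨x, hx, hxn⟩ : ∃ x ∈ Set.Ico (0 : ℝ) 1, x ∉ bad ∪ bad' ∪ E' := by
    by_contra hcon
    push Not at hcon
    have h1 : volume (Set.Ico (0 : ℝ) 1) ≤ volume bad + volume bad' + volume E' :=
      (measure_mono hcon).trans ((measure_union_le _ _).trans
        (add_le_add (measure_union_le _ _) le_rfl))
    have h2 : volume bad + volume bad' + volume E' <
        ENNReal.ofReal (1 / 8) + ENNReal.ofReal (1 / 8) + ENNReal.ofReal (3 / 4) :=
      ENNReal.add_lt_add_of_lt_of_le (hE.trans_lt ENNReal.ofReal_lt_top).ne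
        (ENNReal.add_lt_add hbad (hbad'vol.trans_lt hbad)) hE
    have h3 := h1.trans_lt h2
    rw [Real.volume_Ico, ← ENNReal.ofReal_add (by norm_num) (by norm_num),
      ← ENNReal.ofReal_add (by norm_num) (by norm_num)] at h3
    norm_num at h3
  simp only [Set.mem_union, not_or] at hxn
  obtain ⟨⟨hx1, hx2⟩, hx3⟩ := hxn
  have hmem : ∀ m < N, Int.fract (x + m * α) ∈ Set.Ioo (0 : ℝ) (1 - 1 / (4 * q)) := by
    intro m hm
    by_contra hc
    exact hx3 ⟨hx, m, hm, hc⟩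
  set x' := Int.fract (x + 1 / (4 * q)) with hx'def
  have hx' : x' ∈ Set.Ico (0 : ℝ) 1 := ⟨Int.fract_nonneg _, Int.fract_lt_one _⟩
  have hshift : ∀ m < N, Int.fract (x' + m * α) = Int.fract (x + m * α) + 1 / (4 * q) := by
    intro m hm
    obtain ⟨h1, h2⟩ := hmem m hm
    have : (0 : ℝ) < 1 / (4 * q) := by positivity
    rw [Int.fract_eq_iff]
    refine ⟨by linarith, by linarith, ⌊x + m * α⌋ - ⌊x + 1 / (4 * q)⌋, ?_⟩
    rw [hx'def, Int.fract, Int.fract]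
    push_cast
    ring
  have hdrop := trimmedSum_le_dropFactor_mul (n := n) (b := b) (C := C) hα hα01 hβ hkb (by omega)
    hx hx' (fun m hm => (hmem m hm).1) hshift
  have g1 : |trimmedSum (rotation α) (powerSing β) N (k N) x / d N - 1| ≤ ε := by
    by_contra hc
    exact hx1 ⟨hx, not_le.1 hc⟩
  have g2 : |trimmedSum (rotation α) (powerSing β) N (k N) x' / d N - 1| ≤ ε := by
    by_contra hc
    exact hx2 ⟨hx, hx', not_le.1 hc⟩
  have g3 := (abs_le.1 g1).2
  have g4 := (abs_le.1 g2).1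
  have g5 : trimmedSum (rotation α) (powerSing β) N (k N) x' / d N ≤
      ρ * (trimmedSum (rotation α) (powerSing β) N (k N) x / d N) := by
    rw [mul_div_assoc']
    gcongr
  have g6 : ρ * (trimmedSum (rotation α) (powerSing β) N (k N) x / d N) ≤ ρ * (1 + ε) :=
    mul_le_mul_of_nonneg_left (by linarith) hρ0
  have g7 : ρ * ε ≤ 1 * ε := by gcongr
  linarith

/-! ## Normalising sequences -/

variable {α β : ℝ} {k : ℕ → ℕ} {d d' : ℕ → ℝ}

lemma UniformTrimmedStrongLaw.weakLaw (h : UniformTrimmedStrongLaw α β k d) :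
    TrimmedWeakLaw α β k d := by
  intro ε hε
  rw [UniformTrimmedStrongLaw, Metric.tendstoUniformlyOn_iff] at h
  refine tendsto_const_nhds.congr' ?_
  filter_upwards [h ε hε] with N hN
  refine (measure_mono_null (fun x hx => ?_) measure_empty).symm
  have h1 := hN x hx.1
  rw [dist_comm, Real.dist_eq] at h1
  exact hx.2.not_gt h1

/-- Two exceptional sets of measure below 1/2 leave a common good point, where the same trimmed sum
is close to both normalisations. -/
lemma TrimmedWeakLaw.tendsto_div (hd : ∀ N, 1 ≤ N → 0 < d N) (h : TrimmedWeakLaw α β k d)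
    (h' : TrimmedWeakLaw α β k d') : Tendsto (fun N => d' N / d N) atTop (𝓝 1) := by
  rw [Metric.tendsto_nhds]
  intro ε hε
  set η : ℝ := min (1 / 2) (ε / 5) with hη
  have hη0 : 0 < η := by positivity
  have hη1 : η ≤ 1 / 2 := min_le_left _ _
  have hη2 : η ≤ ε / 5 := min_le_right _ _
  have hhalf : (0 : ENNReal) < ENNReal.ofReal (1 / 2) := by
    rw [ENNReal.ofReal_pos]
    norm_num
  filter_upwards [(h η hη0).eventually_lt_const hhalf, (h' η hη0).eventually_lt_const hhalf,
    eventually_ge_atTop 1] with N h1 h2 hN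
  obtain ⟨x, hx, hxn⟩ : ∃ x ∈ Set.Ico (0 : ℝ) 1,
      |trimmedSum (rotation α) (powerSing β) N (k N) x / d N - 1| ≤ η ∧
      |trimmedSum (rotation α) (powerSing β) N (k N) x / d' N - 1| ≤ η := by
    by_contra hcon
    push Not at hcon
    have h3 := (measure_mono (μ := volume) (s := Set.Ico (0 : ℝ) 1) fun x hx => by
      rcases le_or_gt (|trimmedSum (rotation α) (powerSing β) N (k N) x / d N - 1|) η with h | h
      · exact Or.inr ⟨hx, hcon x hx h⟩
      · exact Or.inl ⟨hx, h⟩).trans_lt ((measure_union_le _ _).trans_lt (ENNReal.add_lt_add h1 h2))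
    rw [Real.volume_Ico, ← ENNReal.ofReal_add (by norm_num) (by norm_num)] at h3
    norm_num at h3
  obtain ⟨h3, h4⟩ := hxn
  have hdN := hd N hN
  set S := trimmedSum (rotation α) (powerSing β) N (k N) x
  rw [abs_le] at h3 h4
  -- Positivity is known for `d` only. A zero of `d'` would make the quotient 0, which is not within
  -- 1/2 of 1.
  have h5 : d' N ≠ 0 := by
    intro h0
    rw [h0, div_zero] at h4
    linarith [h4.1]
  have hS : 0 < S := by
    by_contra hc
    have : S / d N ≤ 0 := div_nonpos_of_nonpos_of_nonneg (not_lt.1 hc) hdN.le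
    linarith [h3.1]
  have e : d' N / d N = (S / d N) / (S / d' N) := by field_simp
  have h6 : 0 < S / d' N := by linarith [h4.1]
  rw [Real.dist_eq, e, abs_lt]
  constructor
  · rw [lt_sub_iff_add_lt, lt_div_iff₀ h6]
    nlinarith
  · rw [sub_lt_iff_lt_add, div_lt_iff₀ h6]
    nlinarith

lemma UniformTrimmedStrongLaw.of_tendsto_div (h : UniformTrimmedStrongLaw α β k d)
    (hd : ∀ᶠ N in atTop, d N ≠ 0)
    (hdd : Tendsto (fun N => d N / d' N) atTop (𝓝 1)) : UniformTrimmedStrongLaw α β k d' := by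
  rw [UniformTrimmedStrongLaw, Metric.tendstoUniformlyOn_iff] at h ⊢
  intro ε hε
  set η : ℝ := min 1 (ε / 4) with hη
  have hη0 : 0 < η := by positivity
  have hη1 : η ≤ 1 := min_le_left _ _
  have hη2 : η ≤ ε / 4 := min_le_right _ _
  filter_upwards [h η hη0, Metric.tendsto_nhds.1 hdd η hη0, hd] with N h1 h2 h3 x hx
  have h4 := h1 x hx
  rw [dist_comm, Real.dist_eq] at h4
  rw [Real.dist_eq] at h2
  set S := trimmedSum (rotation α) (powerSing β) N (k N) x
  have e : S / d' N = (S / d N) * (d N / d' N) := by field_simp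
  rw [dist_comm, Real.dist_eq, e]
  set u := S / d N
  set v := d N / d' N
  calc |u * v - 1| = |(u - 1) * (v - 1) + (u - 1) + (v - 1)| := by ring_nf
    _ ≤ |u - 1| * |v - 1| + |u - 1| + |v - 1| := by
      refine (abs_add_le _ _).trans (add_le_add ((abs_add_le _ _).trans ?_) le_rfl)
      rw [abs_mul]
    _ < ε := by nlinarith [abs_nonneg (u - 1), abs_nonneg (v - 1)]

lemma OstrowskiGrowth.eventually_powerNorm_pos (hα : Irrational α) (hβ : 1 < β)
    (hg : OstrowskiGrowth α k) : ∀ᶠ N in atTop, 0 < powerNorm β k N := by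
  filter_upwards [(hg.tendsto hα).eventually_gt_atTop 0, eventually_ge_atTop 1] with N hk hN
  have hN' : (0 : ℝ) < N := by exact_mod_cast hN
  have hβ1 : 0 < β - 1 := by linarith
  unfold powerNorm
  positivity

theorem tfae_trimmedLaws_of_norm (hα : Irrational α) (hα01 : α ∈ Set.Ioo (0 : ℝ) 1) (hβ : 1 < β)
    (hk : Monotone k ∨ Antitone k)
    (hko : (fun N => (k N : ℝ)) =o[atTop] (fun N : ℕ => (N : ℝ)))
    (hd : ∀ N, 1 ≤ N → 0 < d N) :
    List.TFAE [UniformTrimmedStrongLaw α β k d, TrimmedWeakLaw α β k d,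
      OstrowskiGrowth α k ∧ d ~[atTop] powerNorm β k] := by
  tfae_have 1 → 2 := UniformTrimmedStrongLaw.weakLaw
  tfae_have 2 → 3 := by
    intro h
    have hg := h.ostrowskiGrowth hα hα01 hβ hk hd
    refine ⟨hg, IsEquivalent.symm ?_⟩
    have hne : ∀ᶠ N in atTop, d N ≠ 0 := by
      filter_upwards [eventually_ge_atTop 1] with N hN using (hd N hN).ne'
    exact (isEquivalent_iff_tendsto_one hne).2
      (h.tendsto_div hd (hg.uniformTrimmedStrongLaw hα hα01 hβ hko).weakLaw)
  tfae_have 3 → 1 := by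
    rintro ⟨hg, hequiv⟩
    have hne : ∀ᶠ N in atTop, d N ≠ 0 := by
      filter_upwards [eventually_ge_atTop 1] with N hN using (hd N hN).ne'
    exact (hg.uniformTrimmedStrongLaw hα hα01 hβ hko).of_tendsto_div
      ((hg.eventually_powerNorm_pos hα hβ).mono fun _ h => h.ne')
      ((isEquivalent_iff_tendsto_one hne).1 hequiv.symm)
  tfae_finish

theorem OstrowskiGrowth.exists_uniformTrimmedStrongLaw (hα : Irrational α)
    (hα01 : α ∈ Set.Ioo (0 : ℝ) 1) (hβ : 1 < β)
    (hko : (fun N => (k N : ℝ)) =o[atTop] (fun N : ℕ => (N : ℝ))) (hg : OstrowskiGrowth α k) :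
    ∃ d : ℕ → ℝ, (∀ N, 1 ≤ N → 0 < d N) ∧ UniformTrimmedStrongLaw α β k d := by
  classical
  -- `powerNorm` vanishes where `k N = 0`, which under the growth condition happens for finitely
  -- many `N` only; it is replaced by 1 there.
  refine ⟨fun N => if 0 < powerNorm β k N then powerNorm β k N else 1, fun N _ => ?_,
    (hg.uniformTrimmedStrongLaw hα hα01 hβ hko).congr ?_⟩
  · dsimp only
    split_ifs with h
    · exact h
    · exact one_pos
  · filter_upwards [hg.eventually_powerNorm_pos hα hβ] with N hN x _
    simp only [if_pos hN]

end TrimmedRotation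

end

theorem mainTheorem7 (α β : ℝ) (hα : Irrational α) (hα01 : α ∈ Set.Ioo (0 : ℝ) 1) (hβ : 1 < β)
    (k : ℕ → ℕ) (hk : Monotone k ∨ Antitone k)
    (hko : (fun N => (k N : ℝ)) =o[atTop] (fun N : ℕ => (N : ℝ))) :
    List.TFAE [
      ∃ d : ℕ → ℝ, (∀ N, 1 ≤ N → 0 < d N) ∧ TrimmedRotation.UniformTrimmedStrongLaw α β k d,
      ∃ d : ℕ → ℝ, (∀ N, 1 ≤ N → 0 < d N) ∧ TrimmedRotation.TrimmedWeakLaw α β k d,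
      TrimmedRotation.OstrowskiGrowth α k] ∧
    (∀ d : ℕ → ℝ, (∀ N, 1 ≤ N → 0 < d N) →
      List.TFAE [
        TrimmedRotation.UniformTrimmedStrongLaw α β k d,
        TrimmedRotation.TrimmedWeakLaw α β k d,
        TrimmedRotation.OstrowskiGrowth α k ∧ d ~[atTop] TrimmedRotation.powerNorm β k]) ∧
    (TrimmedRotation.OstrowskiGrowth α k →
      TrimmedRotation.UniformTrimmedStrongLaw α β k (TrimmedRotation.powerNorm β k)) := by
  refine ⟨?_, fun d hd => TrimmedRotation.tfae_trimmedLaws_of_norm hα hα01 hβ hk hko hd,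
    fun hg => hg.uniformTrimmedStrongLaw hα hα01 hβ hko⟩
  tfae_have 1 → 2 := fun ⟨d, hd, h⟩ => ⟨d, hd, h.weakLaw⟩
  tfae_have 2 → 3 := fun ⟨_, hd, h⟩ => h.ostrowskiGrowth hα hα01 hβ hk hd
  tfae_have 3 → 1 := fun hg => hg.exists_uniformTrimmedStrongLaw hα hα01 hβ hko
  tfae_finish
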